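/- **Setting.** A process is a Borel probability measure $\mu$ on $\mathbb R^{\mathbb N}$, $\mathbb N=\{1,2,\dots\}$. For a (finite or infinite) sequence $x$ with at least $n$ terms and a Borel set $B\subseteq\mathbb R^u$, let $\mu_n(x,B)=\frac1{n-u+1}\sum_{i=1}^{n-u+1}\mathbb I\{(x_i,\dots,x_{i+u-1})\in B\}$ if $n\ge u$, and $\mu_n(x,B)=0$ otherwise; let $\mu(B)=\mu(X_{1..u}\in B)$. The process $\mu$ is stationary ergodic if it is stationary and $\mu_n(x,B)\to\mu(B)$ for $\mu$-almost every $x$, for all $u$ and all Borel $B\subseteq\mathbb R^u$. Let $\Delta_{u,v}$ be the partition of $\mathbb R^u$ into the half-open dyadic cubes of side $2^{-v}$, and let $(w_j)_{j\ge1}$ be any summable sequence of positive weights (e.g. $w_j=\frac{1}{j(j+1)}$). Put $$d(\mu,\mu')=\sum_{u,v\ge1}w_uw_v\sum_{B\in\Delta_{u,v}}|\mu(B)-\mu'(B)|,\qquad \widehat d_n(x,x')=\sum_{u,v\ge1}w_uw_v\sum_{B\in\Delta_{u,v}}|\mu_n(x,B)-\mu_n(x',B)|.$$ A piecewise stationary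 ergodic process with $\kappa\ge0$ change points is given by a probability measure $\rho$ on $(\mathbb R^{\mathbb N})^{\kappa+1}$ whose marginals $\mu_1,\dots,\mu_{\kappa+1}$ are stationary ergodic with $\mu_i\ne\mu_{i+1}$, and by numbers $0=\theta_0<\theta_1<\dots<\theta_{\kappa+1}<1$. Put $\tau_i(n)=\lfloor n\theta_i\rfloor$ and $\mathcal M(\rho)=\{\mu_1,\dots,\mu_{\kappa+1}\}$. If $X=(X_{i,t})$ has law $\rho$, the $n$-th sample is the sequence $\mathbf y(n)$ of length $N=\lfloor n\theta_{\kappa+1}\rfloor$ with $Y_t=X_{i+1,\,t-\tau_i(n)}$ for $\tau_i(n)<t\le\tau_{i+1}(n)$, $0\le i\le\kappa$; its change points are $\tau_1(n),\dots,\tau_\kappa(n)$. Two such processes are equivalent if they have the same set $\mathcal M(\rho)$, and the distance between the classes $C$ of $(\rho,\theta)$ and $C'$ of $(\rho',\theta')$ is $$\delta(C,C')=\max_{\mu\in\mathcal M(\rho)}\min_{\mu'\in\mathcal M(\rho')}d(\mu,\mu')+\max_{\mu'\in\mathcal M(\rho')}\min_{\mu\in\mathcal M(\rho)}d(\mu',\mu).$$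 A list-estimator $\mathcal L$ maps each sample $\mathbf y\in\mathbb R^N$ and each parameter $\lambda$ to a list $\psi_1<\dots<\psi_K$ of elements of $\{1,\dots,N\}$ (with $K$ depending on $\mathbf y$ and $\lambda$). It is called *consistent with $\lambda$-separated candidates* if for every piecewise stationary ergodic process $(\rho,\theta)$ and every $\lambda$ with $0<\lambda\le\min_{1\le i\le\kappa+1}(\theta_i-\theta_{i-1})$, $\rho$-almost surely, applying it to the samples $\mathbf y(n)$ of length $N=N(n)$: * for all large $n$ the list contains $\kappa$ distinct candidates $\psi_{i^*_1}(n),\dots,\psi_{i^*_\kappa}(n)$ such that $\lim_{n\to\infty}\max_{1\le k\le\kappa}\frac1N|\psi_{i^*_k}(n)-\tau_k(n)|=0$; * for all large $n$, $\psi_i-\psi_{i-1}\ge\lambda N$ for $i=1,\dots,K+1$, where $\psi_0=0$ and $\psi_{K+1}=N$. **Algorithm.** Given $\mathbf y\in\mathbb R^{n_1}$, $\mathbf y'\in\mathbb R^{n_2}$ and $\lambda$, let $\psi_1<\dots<\psi_K$ be the candidates $\mathcal L(\mathbf y,\lambda)$, and let $\mathcal S$ be the set of the segments $\mathbf y_{\psi_{i-1}..\psi_i}$,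 $i=1,\dots,K+1$, where now $\psi_0=1$ and $\psi_{K+1}=n_1$; define $\mathcal S'$ likewise from $\mathbf y'$. With $m=\lfloor\min\{\lambda n_1,\lambda n_2\}\rfloor$, output $$\delta(\mathbf y,\mathbf y',\lambda)=\max_{s\in\mathcal S}\min_{s'\in\mathcal S'}\widehat d_m(s,s')+\max_{s'\in\mathcal S'}\min_{s\in\mathcal S}\widehat d_m(s',s).$$ (Segments with fewer than $m$ terms, which occur only for finitely many $n$ below, are padded by zeros.) **Proposition.** A list-estimator that is consistent with $\lambda$-separated candidates exists. Let $\mathcal L$ be any such list-estimator, let $(\rho,\theta)$ and $(\rho',\theta')$ be piecewise stationary ergodic processes with classes $C$ and $C'$, let $P$ be any joint probability law with marginals $\rho$ and $\rho'$ (the two samples may be dependent), and let $\mathbf y(n),\mathbf y'(n)$ be the corresponding $n$-th samples. Let $\alpha>0$ be the smallest of all the differences $\theta_i-\theta_{i-1}$ and $\theta'_j-\theta'_{j-1}$. Then for every $\lambda\in(0,\alpha]$, $$\lim_{n\to\infty}\delta(\mathbf y(n),\mathbf y'(n),\lambda)=\delta(C,C')\qquad P\text{-almost surely}.$$ -/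

import Mathlib

open MeasureTheory Filter Topology

noncomputable section

/-! ### Stationary ergodic processes

Time is indexed from `0`: coordinate `t` of a path `x : ℕ → ℝ` is the variable `X_{t+1}`. -/

/-- The empirical measure `μ_n(x, B)` of `B ⊆ ℝ^u`: the frequency of `B` among the `n - u + 1`
windows of length `u` in the first `n` terms of `x` (and `0` if `n < u`). -/
def empiricalMeasure (n : ℕ) (x : ℕ → ℝ) (u : ℕ) (B : Set (Fin u → ℝ)) : ℝ :=
  if u ≤ n then
    (∑ i ∈ Finset.range (n - u + 1), B.indicator (fun _ => (1 : ℝ)) (fun j : Fin u => x (i + j))) /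
      ((n - u + 1 : ℕ) : ℝ)
  else 0

/-- `μ(B) = μ(X_{1..u} ∈ B)`, for `B ⊆ ℝ^u`. -/
def processProb (μ : Measure (ℕ → ℝ)) (u : ℕ) (B : Set (Fin u → ℝ)) : ℝ :=
  μ.real {x | (fun j : Fin u => x j) ∈ B}

def IsStationaryProcess (μ : Measure (ℕ → ℝ)) : Prop :=
  ∀ (u : ℕ) (B : Set (Fin u → ℝ)), MeasurableSet B → ∀ j : ℕ,
    μ {x | (fun i : Fin u => x i) ∈ B} = μ {x | (fun i : Fin u => x (i + j)) ∈ B}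

/-- A stationary process is ergodic if all empirical frequencies converge almost surely to the
corresponding probabilities. -/
def IsStationaryErgodic (μ : Measure (ℕ → ℝ)) : Prop :=
  IsStationaryProcess μ ∧
    ∀ (u : ℕ) (B : Set (Fin u → ℝ)), MeasurableSet B →
      ∀ᵐ x ∂μ, Tendsto (fun n => empiricalMeasure n x u B) atTop (𝓝 (processProb μ u B))

/-! ### Distributional distance -/

/-- The half-open dyadic cube of `ℝ^u` of side `2^{-v}` with lower corner `i / 2^v`. For fixed
`u, v` these cubes, `i ∈ ℤ^u`, partition `ℝ^u`. -/
def dyadicCube (u v : ℕ) (i : Fin u → ℤ) : Set (Fin u → ℝ) :=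
  {x | ∀ j, (i j : ℝ) / 2 ^ v ≤ x j ∧ x j < ((i j : ℝ) + 1) / 2 ^ v}

/-- `∑_{u,v ≥ 1} w_u w_v ∑_{B ∈ Δ_{u,v}} |p(B) - q(B)|`; the value `w j` is the weight of index
`j + 1`. -/
def cubeDist (w : ℕ → ℝ) (p q : (u : ℕ) → Set (Fin u → ℝ) → ℝ) : ℝ :=
  ∑' u : ℕ, ∑' v : ℕ, w u * w v *
    ∑' i : Fin (u + 1) → ℤ,
      |p (u + 1) (dyadicCube (u + 1) (v + 1) i) - q (u + 1) (dyadicCube (u + 1) (v + 1) i)|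

/-- The distributional distance `d(μ, μ')`. -/
def distributionalDist (w : ℕ → ℝ) (μ μ' : Measure (ℕ → ℝ)) : ℝ :=
  cubeDist w (processProb μ) (processProb μ')

/-- The empirical distance `d̂_n(x, x')` of two finite sequences, computed from the first `n` terms
of each. (The padding by `0` is never read when both sequences have at least `n` terms.) -/
def empiricalDist (w : ℕ → ℝ) (n : ℕ) (x x' : List ℝ) : ℝ :=
  cubeDist w (empiricalMeasure n fun i => x.getD i 0) (empiricalMeasure n fun i => x'.getD i 0)

/-- `max_{a ∈ S} min_{b ∈ T} f a b`; it is used for finite non-empty `S` and `T` only. -/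
def maxMin {A B : Type*} (f : A → B → ℝ) (S : Set A) (T : Set B) : ℝ :=
  sSup ((fun a => sInf ((fun b => f a b) '' T)) '' S)

/-! ### Piecewise stationary ergodic processes -/

/-- A piecewise stationary ergodic process with `κ` change points: a joint law `ρ` of `κ + 1`
real-valued sequences with stationary ergodic marginals, consecutive ones being different, together
with the parameters `0 = θ_0 < θ_1 < ⋯ < θ_{κ+1} < 1` of the segment boundaries. -/
structure PSEProcess where
  κ : ℕ
  ρ : Measure (Fin (κ + 1) → ℕ → ℝ)
  isProbabilityMeasure : IsProbabilityMeasure ρ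
  θ : Fin (κ + 2) → ℝ
  θ_zero : θ 0 = 0
  θ_strictMono : StrictMono θ
  θ_last_lt_one : θ (Fin.last (κ + 1)) < 1
  stationaryErgodic : ∀ i, IsStationaryErgodic (ρ.map fun X => X i)
  consecutive_ne : ∀ i : Fin κ, (ρ.map fun X => X i.castSucc) ≠ ρ.map fun X => X i.succ

namespace PSEProcess

/-- The set `M(ρ)` of stationary-segment distributions. -/
def marginals (p : PSEProcess) : Set (Measure (ℕ → ℝ)) :=
  Set.range fun i => p.ρ.map fun X => X i

/-- The segment boundaries `τ_i(n) = ⌊n θ_i⌋`, `i = 0, …, κ + 1`. -/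
def boundary (p : PSEProcess) (n : ℕ) (i : Fin (p.κ + 2)) : ℕ := ⌊(n : ℝ) * p.θ i⌋₊

/-- The `k`-th change point `τ_k(n)`; the index `k : Fin κ` stands for `k + 1 ∈ 1..κ`. -/
def changePoint (p : PSEProcess) (n : ℕ) (k : Fin p.κ) : ℕ := p.boundary n k.succ.castSucc

/-- The length `⌊n θ_{κ+1}⌋` of the `n`-th sample. -/
def sampleLength (p : PSEProcess) (n : ℕ) : ℕ := p.boundary n (Fin.last (p.κ + 1))

/-- The row of the matrix that generates time `t`: the largest `i` with `τ_i(n) ≤ t`. -/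
def row (p : PSEProcess) (n t : ℕ) : Fin (p.κ + 1) :=
  (Finset.univ.filter fun i : Fin (p.κ + 1) => p.boundary n i.castSucc ≤ t).sup id

/-- The `n`-th sample read off from the matrix `X`: its segment number `i`, which occupies the times
`τ_i(n) ≤ t < τ_{i+1}(n)`, consists of the first terms of row `i` of `X`. -/
def sample (p : PSEProcess) (n : ℕ) (X : Fin (p.κ + 1) → ℕ → ℝ) : Fin (p.sampleLength n) → ℝ :=
  fun t => X (p.row n t) (t - p.boundary n (p.row n t).castSucc)

/-- The normalized minimum separation `min_i (θ_i - θ_{i-1})`. -/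
def minSeparation (p : PSEProcess) : ℝ :=
  ⨅ i : Fin (p.κ + 1), (p.θ i.succ - p.θ i.castSucc)

/-- Two processes are equivalent if they have the same set of stationary-segment distributions. -/
instance setoid : Setoid PSEProcess where
  r p q := p.marginals = q.marginals
  iseqv := ⟨fun _ => rfl, fun h => h.symm, fun h₁ h₂ => h₁.trans h₂⟩

end PSEProcess

/-- The set of equivalence classes of piecewise stationary ergodic processes. -/
abbrev PSEClass : Type := Quotient PSEProcess.setoid

/-- The distance `δ(C, C')` between two equivalence classes. -/
def classDist (w : ℕ → ℝ) : PSEClass → PSEClass → ℝ :=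
  Quotient.lift₂
    (fun p q : PSEProcess =>
      maxMin (distributionalDist w) p.marginals q.marginals +
        maxMin (distributionalDist w) q.marginals p.marginals)
    (fun p q p' q' (hp : p.marginals = p'.marginals) (hq : q.marginals = q'.marginals) => by
      simp only [hp, hq])

/-! ### List-estimators -/

/-- A list-estimator maps a sample of any length `N` and a parameter to a sorted list
`ψ_1 < ⋯ < ψ_K` of candidate change points in `{1, …, N}`. -/
structure ListEstimator where
  candidates : (N : ℕ) → (Fin N → ℝ) → ℝ → List ℕ
  sorted : ∀ N y lam, (candidates N y lam).Pairwise (· < ·)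
  mem_range : ∀ N y lam, ∀ t ∈ candidates N y lam, 1 ≤ t ∧ t ≤ N

namespace ListEstimator

/-- Consistency: for every piecewise stationary ergodic process and every parameter not exceeding
its minimum separation, almost surely the list contains, for all large `n`, `κ` distinct candidates
`ψ_{i*_1}(n), …, ψ_{i*_κ}(n)` that estimate the change points with error `o(n)`. -/
def IsConsistent (L : ListEstimator) : Prop :=
  ∀ (p : PSEProcess) (lam : ℝ), 0 < lam → lam ≤ p.minSeparation →
    ∀ᵐ X ∂p.ρ, ∃ ψ : ℕ → Fin p.κ → ℕ,
      (∀ᶠ n in atTop, Function.Injective (ψ n) ∧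
        ∀ k, ψ n k ∈ L.candidates (p.sampleLength n) (p.sample n X) lam) ∧
      ∀ k, Tendsto
        (fun n => |(ψ n k : ℝ) - p.changePoint n k| / (p.sampleLength n : ℝ)) atTop (𝓝 0)

/-- With `ψ_0 = 0` and `ψ_{K+1} = N`, where `N` is the length of the sample, consecutive elements of
`ψ_0, ψ_1, …, ψ_{K+1}` are at least `λ N` apart; almost surely, for all large `n`. -/
def IsSeparated (L : ListEstimator) : Prop :=
  ∀ (p : PSEProcess) (lam : ℝ), 0 < lam → lam ≤ p.minSeparation →
    ∀ᵐ X ∂p.ρ, ∀ᶠ n in atTop,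
      (0 :: (L.candidates (p.sampleLength n) (p.sample n X) lam ++ [p.sampleLength n])).IsChain
        fun a b => (a : ℝ) + lam * (p.sampleLength n : ℝ) ≤ (b : ℝ)

end ListEstimator

/-! ### The estimator of `δ` -/

/-- The segment `y_{a..b} = (y_a, …, y_b)`, indices starting at `1`. -/
def sampleSegment {N : ℕ} (y : Fin N → ℝ) (a b : ℕ) : List ℝ :=
  ((List.ofFn y).take b).drop (a - 1)

/-- The set of the segments `y_{ψ_{i-1}..ψ_i}`, `i = 1, …, K + 1`, where `ψ_1, …, ψ_K` are the
candidates, `ψ_0 = 1` and `ψ_{K+1} = N`. -/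
def segmentSet (L : ListEstimator) (lam : ℝ) {N : ℕ} (y : Fin N → ℝ) : Set (List ℝ) :=
  {s | ∃ ab ∈ List.zip (1 :: L.candidates N y lam) (L.candidates N y lam ++ [N]),
    s = sampleSegment y ab.1 ab.2}

/-- The output `δ(y, y', λ)` of the algorithm; the empirical distances use the first
`⌊min (λ n₁) (λ n₂)⌋` terms of each segment. -/
def deltaEstimate (w : ℕ → ℝ) (L : ListEstimator) (lam : ℝ) {n₁ n₂ : ℕ}
    (y : Fin n₁ → ℝ) (y' : Fin n₂ → ℝ) : ℝ :=
  maxMin (empiricalDist w ⌊min (lam * n₁) (lam * n₂)⌋₊)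
      (segmentSet L lam y) (segmentSet L lam y') +
    maxMin (empiricalDist w ⌊min (lam * n₁) (lam * n₂)⌋₊)
      (segmentSet L lam y') (segmentSet L lam y)

end

/-!
Everything rests on one almost sure property of a piecewise stationary ergodic process,
`PSEProcess.ae_hasLinearHits`: for each dyadic cube `B`, the number of visits of the `n`-th sample to
`B` is, up to `o(n)` and uniformly in time, a continuous piecewise linear function whose slope on
segment `k` is the probability of `B` under the law of that segment. This follows row by row from
the convergence of frequencies, so the dependence between the segments plays no role. All further
arguments are deterministic.

*Existence of a list-estimator.* Among all sets of candidates that are `λN` apart, `minBendEstimator`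
takes one for which the counting functions of all dyadic cubes are as close to affine as possible
between consecutive candidates. The deviation from affinity is measured by second differences
(`bend`), summed over the cubes with geometric weights (`totalBend`). The set of true change points
is admissible for large `n` because `θ_{κ+1} < 1`, and its total bend tends to `0`; hence so does the
minimum. Conversely, the laws before and after a change point differ on some dyadic cube
(`process_eq_of_processProb_dyadicCube`), whose counting function has a kink there. A set that stays
away from the change point by `εn` therefore has a bend bounded below
(`PSEProcess.HasLinearHits.eventually_exists_near`).

*Convergence of the distance estimate.* Every change point has a candidate within `o(n)`, so
a segment between consecutive candidates lies in one stationary segment up to `o(n)` terms, and every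
stationary segment contains, up to `o(n)` terms, a segment of the list. Since the windows used have
linear length, their frequencies of each dyadic cube converge to the probabilities under the
corresponding law, uniformly in the position of the window. By Scheffé's lemma
(`tendsto_tsum_abs_sub`) and dominated convergence the distributional distance between the empirical
measure and that law tends to `0`. Finally the triangle inequality and the stability of maximin
values under approximation (`abs_maxMin_sub_le`) give the limit.
-/

/-! ### Hit counts -/

/-- The number of `i < t` at which the window `(x_i, …, x_{i+u-1})` lies in `B`. -/
noncomputable def hitCount (x : ℕ → ℝ) (u : ℕ) (B : Set (Fin u → ℝ)) (t : ℕ) : ℝ :=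
  ∑ i ∈ Finset.range t, B.indicator (fun _ => (1 : ℝ)) (fun j : Fin u => x (i + j))

/-- The deviation of the hit count from the linear growth at rate `q`. -/
noncomputable def excess (x : ℕ → ℝ) (u : ℕ) (B : Set (Fin u → ℝ)) (q : ℝ) (t : ℕ) : ℝ :=
  hitCount x u B t - t * q

lemma empiricalMeasure_eq_hitCount_div (x : ℕ → ℝ) {u n : ℕ} (h : u ≤ n)
    (B : Set (Fin u → ℝ)) :
    empiricalMeasure n x u B = hitCount x u B (n - u + 1) / ((n - u + 1 : ℕ) : ℝ) := by
  simp [empiricalMeasure, h, hitCount]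

lemma indicator_one_nonneg {A : Type*} (B : Set A) (z : A) :
    0 ≤ B.indicator (fun _ => (1 : ℝ)) z :=
  Set.indicator_nonneg (fun _ _ => zero_le_one) z

lemma indicator_one_le_one {A : Type*} (B : Set A) (z : A) :
    B.indicator (fun _ => (1 : ℝ)) z ≤ 1 :=
  Set.indicator_le' (fun _ _ => le_rfl) (fun _ _ => zero_le_one) z

lemma abs_excess_sub_le (x : ℕ → ℝ) (u : ℕ) (B : Set (Fin u → ℝ)) {q : ℝ} (hq0 : 0 ≤ q)
    (hq1 : q ≤ 1) (s t : ℕ) :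
    |excess x u B q s - excess x u B q t| ≤ |(s : ℝ) - t| := by
  wlog hst : s ≤ t generalizing s t with H
  · rw [abs_sub_comm, abs_sub_comm (s : ℝ)]
    exact H t s (not_le.1 hst).le
  obtain ⟨d, rfl⟩ := Nat.exists_eq_add_of_le hst
  induction d with
  | zero => simp
  | succ d ih =>
    have ih := ih (by omega)
    have hstep : |excess x u B q (s + d) - excess x u B q (s + (d + 1))| ≤ 1 := by
      have h0 := indicator_one_nonneg B (fun j : Fin u => x (s + d + j))
      have h1 := indicator_one_le_one B (fun j : Fin u => x (s + d + j))
      rw [excess, excess, hitCount, hitCount, ← add_assoc, Finset.sum_range_succ, abs_le]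
      push_cast
      constructor <;> linarith
    have htri := abs_sub_le (excess x u B q s) (excess x u B q (s + d))
      (excess x u B q (s + (d + 1)))
    push_cast at ih ⊢
    have e1 : |(s : ℝ) - (s + d)| = d := by
      rw [abs_sub_comm, add_sub_cancel_left]; exact abs_of_nonneg (by positivity)
    have e2 : |(s : ℝ) - (s + (d + 1))| = d + 1 := by
      rw [abs_sub_comm, add_sub_cancel_left]; exact abs_of_nonneg (by positivity)
    linarith

lemma excess_zero (x : ℕ → ℝ) (u : ℕ) (B : Set (Fin u → ℝ)) (q : ℝ) : excess x u B q 0 = 0 := by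
  simp [excess, hitCount]

/-- Convergence of the frequencies to `q` makes the excess over the rate `q` sublinear. -/
lemma exists_abs_excess_le {x : ℕ → ℝ} {u : ℕ} {B : Set (Fin (u + 1) → ℝ)} {q : ℝ}
    (hq0 : 0 ≤ q) (hq1 : q ≤ 1)
    (h : Tendsto (fun n => empiricalMeasure n x (u + 1) B) atTop (𝓝 q)) {ε : ℝ} (hε : 0 < ε) :
    ∃ C : ℝ, 0 ≤ C ∧ ∀ t : ℕ, |excess x (u + 1) B q t| ≤ ε * t + C := by
  obtain ⟨R, hR⟩ := Metric.tendsto_atTop.1 h ε hε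
  refine ⟨R + 1, by positivity, fun t => ?_⟩
  rcases lt_or_ge t (R + 1) with ht | ht
  · have h1 := abs_excess_sub_le x (u + 1) B hq0 hq1 t 0
    rw [excess_zero, sub_zero, Nat.cast_zero, sub_zero, Nat.abs_cast] at h1
    have h2 : (t : ℝ) ≤ R + 1 := by exact_mod_cast ht.le
    have h3 : 0 ≤ ε * t := by positivity
    linarith
  · have h1 := hR (t + u) (by omega)
    rw [empiricalMeasure_eq_hitCount_div x (by omega), show t + u - (u + 1) + 1 = t by omega,
      Real.dist_eq] at h1
    have ht0 : (0 : ℝ) < t := by exact_mod_cast (by omega : 0 < t)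
    have h2 : excess x (u + 1) B q t = (hitCount x (u + 1) B t / t - q) * t := by
      rw [excess]; field_simp
    rw [h2, abs_mul, Nat.abs_cast]
    have := mul_le_mul_of_nonneg_right h1.le ht0.le
    have hR0 : (0 : ℝ) ≤ R := by positivity
    linarith

/-! ### Dyadic cubes -/

/-- The lower corner, in units of `2^{-v}`, of the dyadic cube of side `2^{-v}` that contains `z`. -/
noncomputable def dyadicIndex (u v : ℕ) (z : Fin u → ℝ) : Fin u → ℤ := fun j => ⌊z j * 2 ^ v⌋

lemma mem_dyadicCube_iff {u v : ℕ} {i : Fin u → ℤ} {z : Fin u → ℝ} :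
    z ∈ dyadicCube u v i ↔ dyadicIndex u v z = i := by
  simp only [dyadicCube, Set.mem_ofPred_eq, dyadicIndex, funext_iff, Int.floor_eq_iff]
  refine forall_congr' fun j => ?_
  rw [div_le_iff₀ (by positivity), lt_div_iff₀ (by positivity)]

lemma measurableSet_dyadicCube (u v : ℕ) (i : Fin u → ℤ) : MeasurableSet (dyadicCube u v i) := by
  have : dyadicCube u v i = ⋂ j, (fun z : Fin u → ℝ => z j) ⁻¹'
      Set.Ico ((i j : ℝ) / 2 ^ v) (((i j : ℝ) + 1) / 2 ^ v) := by
    ext z; simp [dyadicCube]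
  rw [this]
  exact MeasurableSet.iInter fun j => measurableSet_Ico.preimage (measurable_pi_apply j)

lemma hasSum_indicator_dyadicCube (u v : ℕ) (z : Fin u → ℝ) :
    HasSum (fun i => (dyadicCube u v i).indicator (fun _ => (1 : ℝ)) z) 1 := by
  have h := hasSum_single (f := fun i => (dyadicCube u v i).indicator (fun _ => (1 : ℝ)) z)
    (dyadicIndex u v z) fun i hi => Set.indicator_of_notMem
      (fun hz => hi (mem_dyadicCube_iff.1 hz).symm) _
  rwa [Set.indicator_of_mem (mem_dyadicCube_iff.2 rfl)] at h

lemma dyadicCube_subset_of_le {u v v' : ℕ} (hv : v ≤ v') {i i' : Fin u → ℤ} {z : Fin u → ℝ}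
    (hz : z ∈ dyadicCube u v i) (hz' : z ∈ dyadicCube u v' i') :
    dyadicCube u v' i' ⊆ dyadicCube u v i := by
  obtain ⟨d, rfl⟩ := Nat.exists_eq_add_of_le hv
  intro y hy j
  have hd : (0 : ℝ) < 2 ^ d := by positivity
  have hvp : (0 : ℝ) < 2 ^ v := by positivity
  have e : ∀ a : ℝ, a / 2 ^ v = a * 2 ^ d / 2 ^ (v + d) := fun a => by
    rw [pow_add]; field_simp
  obtain ⟨h1, h2⟩ := hz j
  obtain ⟨h3, h4⟩ := hz' j
  obtain ⟨h5, h6⟩ := hy j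
  have hp : (0 : ℝ) < 2 ^ (v + d) := by positivity
  rw [e] at h1 h2 ⊢
  rw [e]
  have a1 : (i j : ℝ) * 2 ^ d < i' j + 1 := (div_lt_div_iff_of_pos_right hp).1 (h1.trans_lt h4)
  have a2 : (i' j : ℝ) < (i j + 1) * 2 ^ d := (div_lt_div_iff_of_pos_right hp).1 (h3.trans_lt h2)
  have b1 : i j * 2 ^ d ≤ i' j := by
    have : i j * 2 ^ d < i' j + 1 := by exact_mod_cast a1
    omega
  have b2 : i' j + 1 ≤ (i j + 1) * 2 ^ d := by
    have : i' j < (i j + 1) * 2 ^ d := by exact_mod_cast a2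
    omega
  constructor
  · refine le_trans ?_ h5
    gcongr
    exact_mod_cast b1
  · refine h6.trans_le ?_
    gcongr
    exact_mod_cast b2

lemma exists_dyadicCube_subset {u : ℕ} {U : Set (Fin u → ℝ)} (hU : IsOpen U) {z : Fin u → ℝ}
    (hz : z ∈ U) : ∃ v : ℕ, dyadicCube u (v + 1) (dyadicIndex u (v + 1) z) ⊆ U := by
  obtain ⟨ε, hε, hb⟩ := Metric.isOpen_iff.1 hU z hz
  obtain ⟨v, hv⟩ := exists_pow_lt_of_lt_one hε (by norm_num : (1 / 2 : ℝ) < 1)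
  refine ⟨v, fun y hy => hb ?_⟩
  have hz' : z ∈ dyadicCube u (v + 1) (dyadicIndex u (v + 1) z) := mem_dyadicCube_iff.2 rfl
  refine (dist_pi_lt_iff hε).2 fun j => ?_
  obtain ⟨h1, h2⟩ := hy j
  obtain ⟨h3, h4⟩ := hz' j
  have e : (1 / 2 : ℝ) ^ v = 1 / 2 ^ v := by rw [div_pow, one_pow]
  have e2 : (1 : ℝ) / 2 ^ (v + 1) ≤ 1 / 2 ^ v :=
    one_div_le_one_div_of_le (by positivity) (pow_le_pow_right₀ (by norm_num) (by omega))
  rw [add_div] at h2 h4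
  rw [Real.dist_eq, abs_lt]
  constructor <;> linarith

lemma measure_eq_of_dyadicCube {u : ℕ} {μ ν : Measure (Fin u → ℝ)} [IsProbabilityMeasure μ]
    [IsProbabilityMeasure ν]
    (h : ∀ (v : ℕ) (i : Fin u → ℤ), μ (dyadicCube u (v + 1) i) = ν (dyadicCube u (v + 1) i)) :
    μ = ν := by
  let G : Set (Set (Fin u → ℝ)) := {s | ∃ (v : ℕ) (i : Fin u → ℤ), dyadicCube u (v + 1) i = s}
  refine ext_of_generate_finite G ?_ ?_ ?_ (by simp)
  · refine le_antisymm ?_ (MeasurableSpace.generateFrom_le ?_)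
    · rw [BorelSpace.measurable_eq (α := Fin u → ℝ)]
      refine MeasurableSpace.generateFrom_le fun U hU => ?_
      -- an open set is the union of the countably many dyadic cubes that it contains
      have hU' : U = ⋃ (c : ℕ × (Fin u → ℤ)) (_ : dyadicCube u (c.1 + 1) c.2 ⊆ U),
          dyadicCube u (c.1 + 1) c.2 := by
        refine Set.Subset.antisymm (fun z hz => ?_) (Set.iUnion₂_subset fun _ hc => hc)
        obtain ⟨v, hv⟩ := exists_dyadicCube_subset hU hz
        exact Set.mem_iUnion₂.2 ⟨(v, _), hv, mem_dyadicCube_iff.2 rfl⟩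
      rw [hU']
      exact MeasurableSet.iUnion fun c => MeasurableSet.iUnion fun _ =>
        MeasurableSpace.measurableSet_generateFrom ⟨c.1, c.2, rfl⟩
    · rintro s ⟨v, i, rfl⟩
      exact measurableSet_dyadicCube _ _ _
  · rintro s ⟨v, i, rfl⟩ t ⟨v', i', rfl⟩ ⟨z, hz, hz'⟩
    rcases le_total v v' with hv | hv
    · have := dyadicCube_subset_of_le (by omega) hz hz'
      exact ⟨v', i', (Set.inter_eq_right.2 this).symm⟩
    · have := dyadicCube_subset_of_le (by omega) hz' hz
      exact ⟨v, i, (Set.inter_eq_left.2 this).symm⟩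
  · rintro s ⟨v, i, rfl⟩
    exact h v i

lemma measurable_firstCoords (u : ℕ) :
    Measurable (fun (x : ℕ → ℝ) (j : Fin u) => x j) :=
  measurable_pi_lambda _ fun j => measurable_pi_apply (j : ℕ)

/-- A process is determined by its probabilities of dyadic cubes. -/
lemma process_eq_of_processProb_dyadicCube {μ ν : Measure (ℕ → ℝ)} [IsProbabilityMeasure μ]
    [IsProbabilityMeasure ν]
    (h : ∀ (u v : ℕ) (i : Fin (u + 1) → ℤ), processProb μ (u + 1) (dyadicCube (u + 1) (v + 1) i) =
      processProb ν (u + 1) (dyadicCube (u + 1) (v + 1) i)) : μ = ν := by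
  have hfin : ∀ u : ℕ, μ.map (fun (x : ℕ → ℝ) (j : Fin (u + 1)) => x j) =
      ν.map (fun (x : ℕ → ℝ) (j : Fin (u + 1)) => x j) := by
    intro u
    have hm := measurable_firstCoords (u + 1)
    have := Measure.isProbabilityMeasure_map (μ := μ) hm.aemeasurable
    have := Measure.isProbabilityMeasure_map (μ := ν) hm.aemeasurable
    refine measure_eq_of_dyadicCube fun v i => ?_
    rw [Measure.map_apply hm (measurableSet_dyadicCube _ _ _),
      Measure.map_apply hm (measurableSet_dyadicCube _ _ _)]
    exact (measureReal_eq_measureReal_iff).1 (h u v i)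
  have hν : IsProjectiveLimit ν fun I : Finset ℕ => ν.map I.restrict := fun I => rfl
  have hμ : IsProjectiveLimit μ fun I : Finset ℕ => ν.map I.restrict := by
    intro I
    obtain ⟨u, hu⟩ : ∃ u, ∀ i ∈ I, i < u + 1 :=
      ⟨I.sup id, fun i hi => Nat.lt_succ_of_le (Finset.le_sup (f := id) hi)⟩
    let g : (Fin (u + 1) → ℝ) → (I → ℝ) := fun z i => z ⟨i, hu i i.2⟩
    have hg : Measurable g := measurable_pi_lambda _ fun i => measurable_pi_apply _
    have hm := measurable_firstCoords (u + 1)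
    have e : (I.restrict : (ℕ → ℝ) → _) = g ∘ fun (x : ℕ → ℝ) (j : Fin (u + 1)) => x j := rfl
    change μ.map I.restrict = ν.map I.restrict
    rw [e, ← Measure.map_map hg hm, hfin u, Measure.map_map hg hm]
  have : ∀ I : Finset ℕ, IsFiniteMeasure (ν.map I.restrict) := fun I => inferInstance
  exact hμ.unique hν

/-! ### Distributional distance -/

/-- The values of `p` on the cubes of each side length are non-negative and sum to at most `1`. -/
structure IsCubeSubprob (p : (u : ℕ) → Set (Fin u → ℝ) → ℝ) : Prop where
  nonneg : ∀ u v i, 0 ≤ p (u + 1) (dyadicCube (u + 1) (v + 1) i)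
  summable : ∀ u v, Summable fun i => p (u + 1) (dyadicCube (u + 1) (v + 1) i)
  tsum_le : ∀ u v, ∑' i, p (u + 1) (dyadicCube (u + 1) (v + 1) i) ≤ 1

lemma hasSum_processProb (μ : Measure (ℕ → ℝ)) [IsProbabilityMeasure μ] (u v : ℕ) :
    HasSum (fun i => processProb μ u (dyadicCube u v i)) 1 := by
  have hm := measurable_firstCoords u
  have hU : ⋃ i, {x : ℕ → ℝ | (fun j : Fin u => x j) ∈ dyadicCube u v i} = Set.univ :=
    Set.eq_univ_of_forall fun x => Set.mem_iUnion.2 ⟨_, mem_dyadicCube_iff.2 rfl⟩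
  have h : HasSum (fun i => μ {x : ℕ → ℝ | (fun j : Fin u => x j) ∈ dyadicCube u v i}) 1 := by
    have := measure_iUnion (μ := μ)
      (f := fun i => {x : ℕ → ℝ | (fun j : Fin u => x j) ∈ dyadicCube u v i})
      (fun i i' hi => Set.disjoint_left.2 fun x hx hx' =>
        hi ((mem_dyadicCube_iff.1 hx).symm.trans (mem_dyadicCube_iff.1 hx')))
      (fun i => hm (measurableSet_dyadicCube u v i))
    rw [hU, measure_univ] at this
    rw [this]
    exact ENNReal.summable.hasSum
  have h2 := ENNReal.hasSum_toReal (f := fun i =>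
    μ {x : ℕ → ℝ | (fun j : Fin u => x j) ∈ dyadicCube u v i}) (by rw [h.tsum_eq]; simp)
  rw [← ENNReal.tsum_toReal_eq (fun i => measure_ne_top μ _), h.tsum_eq] at h2
  simpa [processProb, measureReal_def] using h2

lemma isCubeSubprob_processProb (μ : Measure (ℕ → ℝ)) [IsProbabilityMeasure μ] :
    IsCubeSubprob (processProb μ) where
  nonneg _ _ _ := measureReal_nonneg
  summable u v := (hasSum_processProb μ (u + 1) (v + 1)).summable
  tsum_le u v := (hasSum_processProb μ (u + 1) (v + 1)).tsum_eq.le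

lemma isCubeSubprob_empiricalMeasure (n : ℕ) (x : ℕ → ℝ) :
    IsCubeSubprob (empiricalMeasure n x) := by
  have hs : ∀ u v, u ≤ n →
      HasSum (fun i => empiricalMeasure n x u (dyadicCube u v i)) 1 := by
    intro u v hu
    simp only [empiricalMeasure, if_pos hu]
    have h := (hasSum_sum (s := Finset.range (n - u + 1)) fun i _ =>
      hasSum_indicator_dyadicCube u v fun j : Fin u => x (i + j)).div_const
        (((n - u + 1 : ℕ) : ℝ))
    rwa [Finset.sum_const, Finset.card_range, nsmul_one, div_self (by positivity)] at h
  have hz : ∀ u v, ¬ u ≤ n →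
      (fun i => empiricalMeasure n x u (dyadicCube u v i)) = fun _ => 0 := by
    intro u v hu
    simp [empiricalMeasure, hu]
  refine ⟨fun u v i => ?_, fun u v => ?_, fun u v => ?_⟩
  · unfold empiricalMeasure
    split_ifs
    · exact div_nonneg (Finset.sum_nonneg fun _ _ => indicator_one_nonneg _ _) (by positivity)
    · exact le_rfl
  · by_cases hu : u + 1 ≤ n
    · exact (hs _ _ hu).summable
    · rw [hz _ _ hu]; exact summable_zero
  · by_cases hu : u + 1 ≤ n
    · exact (hs _ _ hu).tsum_eq.le
    · rw [hz _ _ hu]; simp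

/-- The total variation between `p` and `q` on the cubes of dimension `u + 1` and side
`2^{-(v+1)}`. -/
noncomputable def cubeVariation (p q : (u : ℕ) → Set (Fin u → ℝ) → ℝ) (u v : ℕ) : ℝ :=
  ∑' i : Fin (u + 1) → ℤ,
    |p (u + 1) (dyadicCube (u + 1) (v + 1) i) - q (u + 1) (dyadicCube (u + 1) (v + 1) i)|

section cubeDist
variable {p q r : (u : ℕ) → Set (Fin u → ℝ) → ℝ} {w : ℕ → ℝ}

lemma cubeVariation_nonneg (p q : (u : ℕ) → Set (Fin u → ℝ) → ℝ) (u v : ℕ) :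
    0 ≤ cubeVariation p q u v := tsum_nonneg fun _ => abs_nonneg _

lemma cubeVariation_le_two (hp : IsCubeSubprob p) (hq : IsCubeSubprob q) (u v : ℕ) :
    cubeVariation p q u v ≤ 2 := by
  have h : cubeVariation p q u v ≤ ∑' i, (p (u + 1) (dyadicCube (u + 1) (v + 1) i) +
      q (u + 1) (dyadicCube (u + 1) (v + 1) i)) := by
    refine Summable.tsum_le_tsum (fun i => ?_) ((hp.summable u v).sub (hq.summable u v)).abs
      ((hp.summable u v).add (hq.summable u v))
    have h1 := hp.nonneg u v i
    have h2 := hq.nonneg u v i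
    rw [abs_le]
    constructor <;> linarith
  rw [(hp.summable u v).tsum_add (hq.summable u v)] at h
  linarith [hp.tsum_le u v, hq.tsum_le u v]

lemma cubeVariation_triangle (hp : IsCubeSubprob p) (hq : IsCubeSubprob q) (hr : IsCubeSubprob r)
    (u v : ℕ) : cubeVariation p r u v ≤ cubeVariation p q u v + cubeVariation q r u v := by
  have h1 := ((hp.summable u v).sub (hq.summable u v)).abs
  have h2 := ((hq.summable u v).sub (hr.summable u v)).abs
  rw [cubeVariation, cubeVariation, cubeVariation, ← h1.tsum_add h2]
  exact Summable.tsum_le_tsum (fun i => abs_sub_le _ _ _)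
    ((hp.summable u v).sub (hr.summable u v)).abs (h1.add h2)

lemma summable_weight_cubeVariation (hw : ∀ j, 0 < w j) (hws : Summable w)
    (hp : IsCubeSubprob p) (hq : IsCubeSubprob q) (u : ℕ) :
    Summable fun v => w u * w v * cubeVariation p q u v := by
  refine Summable.of_nonneg_of_le
    (fun v => mul_nonneg (mul_pos (hw u) (hw v)).le (cubeVariation_nonneg p q u v))
    (fun v => ?_) ((hws.mul_left (w u)).mul_right 2)
  exact mul_le_mul_of_nonneg_left (cubeVariation_le_two hp hq u v) (mul_pos (hw u) (hw v)).le

lemma tsum_weight_cubeVariation_le (hw : ∀ j, 0 < w j) (hws : Summable w)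
    (hp : IsCubeSubprob p) (hq : IsCubeSubprob q) (u : ℕ) :
    ∑' v, w u * w v * cubeVariation p q u v ≤ w u * (∑' v, w v) * 2 := by
  rw [← tsum_mul_left, ← tsum_mul_right]
  exact Summable.tsum_le_tsum (fun v => mul_le_mul_of_nonneg_left (cubeVariation_le_two hp hq u v)
    (mul_pos (hw u) (hw v)).le) (summable_weight_cubeVariation hw hws hp hq u)
    ((hws.mul_left (w u)).mul_right 2)

lemma tsum_weight_cubeVariation_nonneg (hw : ∀ j, 0 < w j) (u : ℕ) :
    0 ≤ ∑' v, w u * w v * cubeVariation p q u v :=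
  tsum_nonneg fun v => mul_nonneg (mul_pos (hw u) (hw v)).le (cubeVariation_nonneg p q u v)

lemma summable_tsum_weight_cubeVariation (hw : ∀ j, 0 < w j) (hws : Summable w)
    (hp : IsCubeSubprob p) (hq : IsCubeSubprob q) :
    Summable fun u => ∑' v, w u * w v * cubeVariation p q u v :=
  Summable.of_nonneg_of_le (fun u => tsum_weight_cubeVariation_nonneg hw u)
    (fun u => tsum_weight_cubeVariation_le hw hws hp hq u) ((hws.mul_right _).mul_right 2)

lemma cubeDist_comm (w : ℕ → ℝ) (p q : (u : ℕ) → Set (Fin u → ℝ) → ℝ) :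
    cubeDist w p q = cubeDist w q p := by
  simp only [cubeDist, abs_sub_comm]

lemma cubeDist_triangle (hw : ∀ j, 0 < w j) (hws : Summable w)
    (hp : IsCubeSubprob p) (hq : IsCubeSubprob q) (hr : IsCubeSubprob r) :
    cubeDist w p r ≤ cubeDist w p q + cubeDist w q r := by
  have h1 := summable_tsum_weight_cubeVariation hw hws hp hq
  have h2 := summable_tsum_weight_cubeVariation hw hws hq hr
  change ∑' u, ∑' v, w u * w v * cubeVariation p r u v ≤
    ∑' u, ∑' v, w u * w v * cubeVariation p q u v + ∑' u, ∑' v, w u * w v * cubeVariation q r u v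
  rw [← h1.tsum_add h2]
  refine Summable.tsum_le_tsum (fun u => ?_) (summable_tsum_weight_cubeVariation hw hws hp hr)
    (h1.add h2)
  have h3 := summable_weight_cubeVariation hw hws hp hq u
  have h4 := summable_weight_cubeVariation hw hws hq hr u
  rw [← h3.tsum_add h4]
  refine Summable.tsum_le_tsum (fun v => ?_) (summable_weight_cubeVariation hw hws hp hr u)
    (h3.add h4)
  rw [← mul_add]
  exact mul_le_mul_of_nonneg_left (cubeVariation_triangle hp hq hr u v) (mul_pos (hw u) (hw v)).le

/-- Changing both arguments changes the distance by at most the sum of the two displacements. -/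
lemma abs_cubeDist_sub_le (hw : ∀ j, 0 < w j) (hws : Summable w)
    {p' q' : (u : ℕ) → Set (Fin u → ℝ) → ℝ}
    (hp : IsCubeSubprob p) (hq : IsCubeSubprob q) (hp' : IsCubeSubprob p')
    (hq' : IsCubeSubprob q') :
    |cubeDist w p q - cubeDist w p' q'| ≤ cubeDist w p p' + cubeDist w q q' := by
  have h1 := cubeDist_triangle hw hws hp hp' hq
  have h2 := cubeDist_triangle hw hws hp' hq' hq
  have h3 := cubeDist_triangle hw hws hp' hp hq'
  have h4 := cubeDist_triangle hw hws hp hq hq'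
  rw [cubeDist_comm w q' q] at h2
  rw [cubeDist_comm w p' p] at h3
  rw [abs_le]
  constructor <;> linarith

end cubeDist

/-- Scheffé's lemma for sums: pointwise convergence to a probability vector is convergence in
`ℓ¹`. -/
lemma tendsto_tsum_abs_sub {α ι : Type*} {l : Filter α} {p : α → ι → ℝ} {q : ι → ℝ}
    (hp0 : ∀ z i, 0 ≤ p z i) (hps : ∀ z, Summable (p z)) (hp1 : ∀ z, ∑' i, p z i ≤ 1)
    (hq0 : ∀ i, 0 ≤ q i) (hq : HasSum q 1) (h : ∀ i, Tendsto (fun z => p z i) l (𝓝 (q i))) :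
    Tendsto (fun z => ∑' i, |p z i - q i|) l (𝓝 0) := by
  have hle : ∀ z i, ‖max (q i - p z i) 0‖ ≤ q i := fun z i => by
    rw [Real.norm_of_nonneg (le_max_right _ _)]
    exact max_le (by linarith [hp0 z i]) (hq0 i)
  have hpos : Tendsto (fun z => 2 * ∑' i, max (q i - p z i) 0) l (𝓝 0) := by
    have h1 := tendsto_tsum_of_dominated_convergence (𝓕 := l)
      (f := fun z i => max (q i - p z i) 0) (g := fun _ => (0 : ℝ)) (bound := q) hq.summable
      (fun i => by
        simpa using ((tendsto_const_nhds (x := q i)).sub (h i)).max (tendsto_const_nhds (x := (0 : ℝ))))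
      (Eventually.of_forall hle)
    simpa using h1.const_mul 2
  refine squeeze_zero (fun z => tsum_nonneg fun _ => abs_nonneg _) (fun z => ?_) hpos
  have hms : Summable fun i => max (q i - p z i) 0 := Summable.of_norm_bounded hq.summable (hle z)
  have e : ∀ i, |p z i - q i| = (p z i - q i) + 2 * max (q i - p z i) 0 := fun i => by
    rcases le_total (q i) (p z i) with h' | h'
    · rw [max_eq_right (by linarith), abs_of_nonneg (by linarith)]; ring
    · rw [max_eq_left (by linarith), abs_of_nonpos (by linarith)]; ring
  rw [tsum_congr e, ((hps z).sub hq.summable).tsum_add (hms.mul_left 2),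
    (hps z).tsum_sub hq.summable, hq.tsum_eq, tsum_mul_left]
  linarith [hp1 z]

/-- Convergence on every dyadic cube to a process is convergence in the distributional distance. -/
lemma tendsto_cubeDist_processProb {α : Type*} {l : Filter α} {w : ℕ → ℝ} (hw : ∀ j, 0 < w j)
    (hws : Summable w) {p : α → (u : ℕ) → Set (Fin u → ℝ) → ℝ} (hp : ∀ z, IsCubeSubprob (p z))
    (μ : Measure (ℕ → ℝ)) [IsProbabilityMeasure μ]
    (h : ∀ u v i, Tendsto (fun z => p z (u + 1) (dyadicCube (u + 1) (v + 1) i)) l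
      (𝓝 (processProb μ (u + 1) (dyadicCube (u + 1) (v + 1) i)))) :
    Tendsto (fun z => cubeDist w (p z) (processProb μ)) l (𝓝 0) := by
  have hμ := isCubeSubprob_processProb μ
  have h0 : ∀ u v, Tendsto (fun z => cubeVariation (p z) (processProb μ) u v) l (𝓝 0) :=
    fun u v => tendsto_tsum_abs_sub (fun z => (hp z).nonneg u v) (fun z => (hp z).summable u v)
      (fun z => (hp z).tsum_le u v) (hμ.nonneg u v) (hasSum_processProb μ _ _) (h u v)
  have h1 : ∀ u, Tendsto (fun z => ∑' v, w u * w v * cubeVariation (p z) (processProb μ) u v) l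
      (𝓝 0) := by
    intro u
    have := tendsto_tsum_of_dominated_convergence (𝓕 := l)
      (f := fun z v => w u * w v * cubeVariation (p z) (processProb μ) u v)
      (g := fun _ => (0 : ℝ)) (bound := fun v => w u * w v * 2)
      ((hws.mul_left (w u)).mul_right 2)
      (fun v => by simpa using (h0 u v).const_mul (w u * w v))
      (Eventually.of_forall fun z v => by
        have hww := (mul_pos (hw u) (hw v)).le
        rw [Real.norm_of_nonneg (mul_nonneg hww (cubeVariation_nonneg _ _ u v))]
        exact mul_le_mul_of_nonneg_left (cubeVariation_le_two (hp z) hμ u v) hww)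
    simpa using this
  have := tendsto_tsum_of_dominated_convergence (𝓕 := l)
    (f := fun z u => ∑' v, w u * w v * cubeVariation (p z) (processProb μ) u v)
    (g := fun _ => (0 : ℝ)) (bound := fun u => w u * (∑' v, w v) * 2)
    ((hws.mul_right _).mul_right 2) h1
    (Eventually.of_forall fun z u => by
      rw [Real.norm_of_nonneg (tsum_weight_cubeVariation_nonneg hw u)]
      exact tsum_weight_cubeVariation_le hw hws (hp z) hμ u)
  simpa [cubeDist, cubeVariation] using this

/-! ### Maximin values of approximately related sets -/

lemma maxMin_le_add {A B A' B' : Type*} {f : A → B → ℝ} {g : A' → B' → ℝ} {S : Set A} {T : Set B}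
    {S' : Set A'} {T' : Set B'} (hS : S.Nonempty) (hT : T.Finite)
    (hS' : S'.Finite) (hT' : T'.Nonempty) {ε : ℝ}
    {R : A → A' → Prop} {Q : B → B' → Prop} (hR : ∀ a ∈ S, ∃ a' ∈ S', R a a')
    (hQ : ∀ b' ∈ T', ∃ b ∈ T, Q b b')
    (h : ∀ a b a' b', R a a' → Q b b' → |f a b - g a' b'| ≤ ε) :
    maxMin f S T ≤ maxMin g S' T' + ε := by
  refine csSup_le (hS.image _) ?_
  rintro _ ⟨a, ha, rfl⟩
  obtain ⟨a', ha', hr⟩ := hR a ha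
  have h1 : sInf ((fun b => f a b) '' T) - ε ≤ sInf ((fun b' => g a' b') '' T') := by
    refine le_csInf (hT'.image _) ?_
    rintro _ ⟨b', hb', rfl⟩
    obtain ⟨b, hb, hq⟩ := hQ b' hb'
    have h2 : sInf ((fun b => f a b) '' T) ≤ f a b :=
      csInf_le (hT.image _).bddBelow ⟨b, hb, rfl⟩
    have h3 := (abs_le.1 (h a b a' b' hr hq)).2
    simp only
    linarith
  have h2 : sInf ((fun b' => g a' b') '' T') ≤ maxMin g S' T' :=
    le_csSup (hS'.image _).bddAbove ⟨a', ha', rfl⟩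
  simp only
  linarith

lemma abs_maxMin_sub_le {A B A' B' : Type*} {f : A → B → ℝ} {g : A' → B' → ℝ} {S : Set A}
    {T : Set B} {S' : Set A'} {T' : Set B'} (hS : S.Nonempty) (hSf : S.Finite) (hT : T.Nonempty)
    (hTf : T.Finite) (hS' : S'.Nonempty) (hSf' : S'.Finite) (hT' : T'.Nonempty) (hTf' : T'.Finite)
    {ε : ℝ} {R : A → A' → Prop} {Q : B → B' → Prop}
    (hR : ∀ a ∈ S, ∃ a' ∈ S', R a a') (hR' : ∀ a' ∈ S', ∃ a ∈ S, R a a')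
    (hQ : ∀ b ∈ T, ∃ b' ∈ T', Q b b') (hQ' : ∀ b' ∈ T', ∃ b ∈ T, Q b b')
    (h : ∀ a b a' b', R a a' → Q b b' → |f a b - g a' b'| ≤ ε) :
    |maxMin f S T - maxMin g S' T'| ≤ ε := by
  have h1 := maxMin_le_add hS hTf hSf' hT' hR hQ' h
  have h2 := maxMin_le_add (f := g) (g := f) (ε := ε) (R := fun a' a => R a a')
    (Q := fun b' b => Q b b') hS' hTf' hSf hT hR' hQ
    (fun a' b' a b hr hq => by rw [abs_sub_comm]; exact h a b a' b' hr hq)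
  rw [abs_le]
  constructor <;> linarith

/-! ### Hit counts along a piecewise stationary ergodic sample -/

/-- A finite sample as a path, continued by `0`. -/
noncomputable def samplePath {N : ℕ} (y : Fin N → ℝ) (t : ℕ) : ℝ := (List.ofFn y).getD t 0

lemma samplePath_of_lt {N : ℕ} (y : Fin N → ℝ) {t : ℕ} (h : t < N) :
    samplePath y t = y ⟨t, h⟩ := by
  simp [samplePath, List.getD_eq_getElem?_getD, h]

lemma exists_castSucc_le_lt_succ {α : Type*} [LinearOrder α] {m : ℕ} (f : Fin (m + 2) → α) {a : α}
    (h : f 0 ≤ a) : ∃ k : Fin (m + 1), f k.castSucc ≤ a ∧ (k = Fin.last m ∨ a < f k.succ) := by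
  classical
  have hne : (Finset.univ.filter fun k : Fin (m + 1) => f k.castSucc ≤ a).Nonempty :=
    ⟨0, by simpa using h⟩
  have hmem := Finset.max'_mem _ hne
  refine ⟨_, (Finset.mem_filter.1 hmem).2, ?_⟩
  set k := Finset.max' _ hne
  by_contra! hcon
  obtain ⟨j, hj⟩ := Fin.exists_castSucc_eq.2 hcon.1
  have h1 : f j.succ.castSucc ≤ a := by
    rw [← Fin.succ_castSucc, hj]; exact hcon.2
  have h2 : j.succ ≤ k := Finset.le_max' _ _ (by simpa using h1)
  rw [← hj] at h2
  exact absurd h2 (not_le.2 Fin.castSucc_lt_succ)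

namespace PSEProcess
variable (p : PSEProcess)

/-- The law of the `k`-th stationary segment. -/
noncomputable def marginal (k : Fin (p.κ + 1)) : Measure (ℕ → ℝ) := p.ρ.map fun X => X k

instance (k : Fin (p.κ + 1)) : IsProbabilityMeasure (p.marginal k) :=
  have := p.isProbabilityMeasure
  Measure.isProbabilityMeasure_map (measurable_pi_apply k).aemeasurable

lemma θ_nonneg (i : Fin (p.κ + 2)) : 0 ≤ p.θ i := by
  rw [← p.θ_zero]; exact p.θ_strictMono.monotone (Fin.zero_le i)

lemma θ_lt_one (i : Fin (p.κ + 2)) : p.θ i < 1 :=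
  (p.θ_strictMono.monotone (Fin.le_last i)).trans_lt p.θ_last_lt_one

lemma θ_last_pos : 0 < p.θ (Fin.last (p.κ + 1)) := by
  rw [← p.θ_zero]; exact p.θ_strictMono (Fin.last_pos)

lemma boundary_mono (n : ℕ) : Monotone (p.boundary n) := fun _ _ h =>
  Nat.floor_mono (mul_le_mul_of_nonneg_left (p.θ_strictMono.monotone h) (Nat.cast_nonneg n))

lemma boundary_zero (n : ℕ) : p.boundary n 0 = 0 := by simp [boundary, p.θ_zero]

lemma boundary_le_mul (n : ℕ) (i) : (p.boundary n i : ℝ) ≤ n * p.θ i :=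
  Nat.floor_le (mul_nonneg (Nat.cast_nonneg n) (p.θ_nonneg i))

lemma mul_lt_boundary_add_one (n : ℕ) (i) : n * p.θ i < p.boundary n i + 1 :=
  Nat.lt_floor_add_one _

lemma boundary_le_sampleLength (n : ℕ) (i) : p.boundary n i ≤ p.sampleLength n :=
  p.boundary_mono n (Fin.le_last i)

lemma sampleLength_le (n : ℕ) : (p.sampleLength n : ℝ) ≤ n :=
  (p.boundary_le_mul n _).trans
    (mul_le_of_le_one_right (Nat.cast_nonneg n) (p.θ_lt_one _).le)

lemma minSeparation_le (i : Fin (p.κ + 1)) : p.minSeparation ≤ p.θ i.succ - p.θ i.castSucc :=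
  ciInf_le (Set.finite_range _).bddBelow i

lemma minSeparation_pos : 0 < p.minSeparation := by
  obtain ⟨i, hi⟩ := exists_eq_ciInf_of_finite
    (f := fun i : Fin (p.κ + 1) => p.θ i.succ - p.θ i.castSucc)
  rw [minSeparation, ← hi]
  exact sub_pos.2 (p.θ_strictMono Fin.castSucc_lt_succ)

/-- The gap `θ_b - θ_a` is at least the minimum separation for all `a < b`. -/
lemma minSeparation_le_sub {a b : Fin (p.κ + 2)} (h : a < b) :
    p.minSeparation ≤ p.θ b - p.θ a := by
  obtain ⟨i, rfl⟩ := Fin.exists_castSucc_eq.2 (ne_of_lt (h.trans_le (Fin.le_last b)))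
  have h1 : p.θ i.succ ≤ p.θ b := p.θ_strictMono.monotone (Fin.castSucc_lt_iff_succ_le.1 h)
  linarith [p.minSeparation_le i]

lemma boundary_gap {a b : Fin (p.κ + 2)} (h : a < b) (n : ℕ) :
    n * p.minSeparation - 1 < (p.boundary n b : ℝ) - p.boundary n a := by
  have h1 := p.boundary_le_mul n a
  have h2 := p.mul_lt_boundary_add_one n b
  have h3 := mul_le_mul_of_nonneg_left (p.minSeparation_le_sub h) (Nat.cast_nonneg (α := ℝ) n)
  linarith [mul_sub (n : ℝ) (p.θ b) (p.θ a)]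

lemma row_eq {n t : ℕ} {k : Fin (p.κ + 1)} (h1 : p.boundary n k.castSucc ≤ t)
    (h2 : t < p.boundary n k.succ) : p.row n t = k := by
  refine le_antisymm (Finset.sup_le fun i hi => ?_)
    (Finset.le_sup (f := id) (Finset.mem_filter.2 ⟨Finset.mem_univ _, h1⟩))
  rw [id, ← not_lt]
  intro hki
  have h3 := p.boundary_mono n (Fin.castSucc_lt_iff_succ_le.1 (Fin.castSucc_lt_castSucc_iff.2 hki))
  exact absurd (h3.trans (Finset.mem_filter.1 hi).2) (not_le.2 h2)

lemma samplePath_sample_add {n : ℕ} (X : Fin (p.κ + 1) → ℕ → ℝ) {k : Fin (p.κ + 1)} {r : ℕ}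
    (h : p.boundary n k.castSucc + r < p.boundary n k.succ) :
    samplePath (p.sample n X) (p.boundary n k.castSucc + r) = X k r := by
  rw [samplePath_of_lt _ (h.trans_le (p.boundary_le_sampleLength n _)), sample]
  simp only [p.row_eq (Nat.le_add_right _ r) h, Nat.add_sub_cancel_left]

/-- The window counts of the sample within segment `k` are those of row `k`, as long as the windows
do not cross the end of the segment. -/
lemma excess_sample_sub_eq {n : ℕ} (X : Fin (p.κ + 1) → ℕ → ℝ) (k : Fin (p.κ + 1)) (u : ℕ)
    (B : Set (Fin (u + 1) → ℝ)) (q : ℝ) {r : ℕ}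
    (h : r ≠ 0 → p.boundary n k.castSucc + r + u ≤ p.boundary n k.succ) :
    excess (samplePath (p.sample n X)) (u + 1) B q (p.boundary n k.castSucc + r) -
      excess (samplePath (p.sample n X)) (u + 1) B q (p.boundary n k.castSucc) =
    excess (X k) (u + 1) B q r := by
  rw [excess, excess, excess, hitCount, hitCount, hitCount, Finset.sum_range_add]
  have : ∀ i ∈ Finset.range r, B.indicator (fun _ => (1 : ℝ)) (fun j : Fin (u + 1) =>
      samplePath (p.sample n X) (p.boundary n k.castSucc + i + j)) =
      B.indicator (fun _ => (1 : ℝ)) (fun j : Fin (u + 1) => X k (i + j)) := by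
    intro i hi
    have hi := Finset.mem_range.1 hi
    congr 1
    funext j
    have hj := j.2
    have := h (by omega)
    rw [add_assoc]
    exact p.samplePath_sample_add X (by omega)
  rw [Finset.sum_congr rfl this]
  push_cast
  ring

/-- For every dyadic cube and every segment, the excess of the hit count in the `n`-th sample over
the growth at the rate of that segment varies by `o(n)` within the segment. -/
def HasLinearHits (X : Fin (p.κ + 1) → ℕ → ℝ) : Prop :=
  ∀ (u v : ℕ) (i : Fin (u + 1) → ℤ) (k : Fin (p.κ + 1)), ∀ ε : ℝ, 0 < ε → ∃ C : ℝ, ∀ n t : ℕ,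
    p.boundary n k.castSucc ≤ t → t ≤ p.boundary n k.succ →
    |excess (samplePath (p.sample n X)) (u + 1) (dyadicCube (u + 1) (v + 1) i)
        (processProb (p.marginal k) (u + 1) (dyadicCube (u + 1) (v + 1) i)) t -
      excess (samplePath (p.sample n X)) (u + 1) (dyadicCube (u + 1) (v + 1) i)
        (processProb (p.marginal k) (u + 1) (dyadicCube (u + 1) (v + 1) i))
        (p.boundary n k.castSucc)| ≤ ε * n + C

lemma processProb_nonneg (μ : Measure (ℕ → ℝ)) (u : ℕ) (B : Set (Fin u → ℝ)) :
    0 ≤ processProb μ u B := measureReal_nonneg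

lemma processProb_le_one (μ : Measure (ℕ → ℝ)) [IsProbabilityMeasure μ] (u : ℕ)
    (B : Set (Fin u → ℝ)) : processProb μ u B ≤ 1 := measureReal_le_one

lemma ae_hasLinearHits : ∀ᵐ X ∂p.ρ, p.HasLinearHits X := by
  have hae : ∀ᵐ X ∂p.ρ, ∀ (u v : ℕ) (i : Fin (u + 1) → ℤ) (k : Fin (p.κ + 1)),
      Tendsto (fun n => empiricalMeasure n (X k) (u + 1) (dyadicCube (u + 1) (v + 1) i)) atTop
        (𝓝 (processProb (p.marginal k) (u + 1) (dyadicCube (u + 1) (v + 1) i))) := by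
    simp only [ae_all_iff]
    intro u v i k
    exact ae_of_ae_map (measurable_pi_apply k).aemeasurable
      ((p.stationaryErgodic k).2 (u + 1) _ (measurableSet_dyadicCube _ _ i))
  filter_upwards [hae] with X hX u v i k ε hε
  set B := dyadicCube (u + 1) (v + 1) i
  set q := processProb (p.marginal k) (u + 1) B
  have hq0 : 0 ≤ q := processProb_nonneg _ _ _
  have hq1 : q ≤ 1 := processProb_le_one _ _ _
  obtain ⟨C, hC0, hC⟩ := exists_abs_excess_le hq0 hq1 (hX u v i k) hε
  refine ⟨C + u, fun n t h1 h2 => ?_⟩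
  -- the largest `r` for which no window that starts before `τ_k + r ≤ t` crosses the boundary
  obtain ⟨r, hrt, hr, htr⟩ : ∃ r, p.boundary n k.castSucc + r ≤ t ∧
      (r ≠ 0 → p.boundary n k.castSucc + r + u ≤ p.boundary n k.succ) ∧
      t ≤ p.boundary n k.castSucc + r + u :=
    ⟨min (t - p.boundary n k.castSucc) (p.boundary n k.succ - u - p.boundary n k.castSucc),
      by omega, by omega, by omega⟩
  have e := p.excess_sample_sub_eq X k u B q hr
  have h3 := hC r
  have h4 := abs_excess_sub_le (samplePath (p.sample n X)) (u + 1) B hq0 hq1 t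
    (p.boundary n k.castSucc + r)
  have h5 : |(t : ℝ) - ((p.boundary n k.castSucc + r : ℕ) : ℝ)| ≤ u := by
    have a1 : ((p.boundary n k.castSucc + r : ℕ) : ℝ) ≤ t := by exact_mod_cast hrt
    have a2 : (t : ℝ) ≤ ((p.boundary n k.castSucc + r : ℕ) : ℝ) + u := by exact_mod_cast htr
    rw [abs_le]
    constructor <;> linarith
  have h6 : (r : ℝ) ≤ n := by
    have a1 : (t : ℝ) ≤ p.sampleLength n := by
      exact_mod_cast h2.trans (p.boundary_le_sampleLength n _)
    have a2 : (r : ℝ) ≤ t := by exact_mod_cast (Nat.le_add_left _ _).trans hrt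
    linarith [p.sampleLength_le n]
  rw [← e] at h3
  have h7 := abs_sub_le (excess (samplePath (p.sample n X)) (u + 1) B q t)
    (excess (samplePath (p.sample n X)) (u + 1) B q (p.boundary n k.castSucc + r))
    (excess (samplePath (p.sample n X)) (u + 1) B q (p.boundary n k.castSucc))
  have h8 := mul_le_mul_of_nonneg_left h6 hε.le
  linarith

/-- `N(n)` grows linearly. -/
lemma eventually_mul_le_sampleLength :
    ∀ᶠ n : ℕ in atTop, p.θ (Fin.last _) / 2 * n ≤ p.sampleLength n := by
  have h := p.θ_last_pos
  filter_upwards [(tendsto_natCast_atTop_atTop (R := ℝ)).eventually_ge_atTop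
    (2 / p.θ (Fin.last _))] with n hn
  have h1 := p.mul_lt_boundary_add_one n (Fin.last _)
  rw [div_le_iff₀ h] at hn
  change _ ≤ ((p.boundary n (Fin.last _) : ℕ) : ℝ)
  linarith

lemma eventually_sampleLength_pos : ∀ᶠ n in atTop, 0 < p.sampleLength n := by
  filter_upwards [p.eventually_mul_le_sampleLength, eventually_gt_atTop 0] with n h1 h2
  have h2 : (0 : ℝ) < n := by exact_mod_cast h2
  have : (0 : ℝ) < p.sampleLength n := (mul_pos (half_pos p.θ_last_pos) h2).trans_le h1
  exact_mod_cast this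

end PSEProcess

/-! ### Separated lists -/

/-- In `ListEstimator.IsSeparated` the list is coerced to a list of reals; this is the same condition
for the list of natural numbers. -/
lemma ListEstimator.isSeparated_iff (L : ListEstimator) :
    L.IsSeparated ↔ ∀ (p : PSEProcess) (lam : ℝ), 0 < lam → lam ≤ p.minSeparation →
      ∀ᵐ X ∂p.ρ, ∀ᶠ n in atTop,
        List.IsChain (fun a b : ℕ => (a : ℝ) + lam * (p.sampleLength n : ℝ) ≤ (b : ℝ))
          (0 :: (L.candidates (p.sampleLength n) (p.sample n X) lam ++ [p.sampleLength n])) := by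
  have h : ∀ (R : ℝ → ℝ → Prop) (l : List ℕ),
      List.IsChain R (do let a ← l; pure (a : ℝ)) ↔ List.IsChain (fun a b : ℕ => R a b) l := by
    intro R l
    rw [bind_pure_comp, List.map_eq_map, List.isChain_map]
  simp only [ListEstimator.IsSeparated, h]

/-! ### Consecutive elements of a list of candidates -/

lemma rel_of_mem_zip {R : ℕ → ℕ → Prop} {h N : ℕ} {c : List ℕ} (hc : (h :: (c ++ [N])).IsChain R)
    {ab : ℕ × ℕ} (hab : ab ∈ List.zip (h :: c) (c ++ [N])) : R ab.1 ab.2 := by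
  induction c generalizing h with
  | nil =>
    obtain rfl : ab = (h, N) := by simpa using hab
    simpa using hc
  | cons d c ih =>
    rw [List.cons_append, List.isChain_cons_cons] at hc
    rw [List.cons_append, List.zip_cons_cons, List.mem_cons] at hab
    rcases hab with rfl | hab
    · exact hc.1
    · exact ih hc.2 hab

lemma le_or_le_of_mem_zip {h N : ℕ} {c : List ℕ} (hc : (h :: (c ++ [N])).Pairwise (· < ·))
    {ab : ℕ × ℕ} (hab : ab ∈ List.zip (h :: c) (c ++ [N])) {t : ℕ} (ht : t ∈ c) :
    t ≤ ab.1 ∨ ab.2 ≤ t := by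
  induction c generalizing h with
  | nil => simp at ht
  | cons d c ih =>
    rw [List.cons_append, List.pairwise_cons] at hc
    rw [List.cons_append, List.zip_cons_cons, List.mem_cons] at hab
    have hd := List.pairwise_cons.1 hc.2
    rcases hab with rfl | hab
    · rcases List.mem_cons.1 ht with rfl | ht
      · exact Or.inr le_rfl
      · exact Or.inr (hd.1 t (List.mem_append_left _ ht)).le
    · rcases List.mem_cons.1 ht with rfl | ht
      · rcases List.mem_cons.1 (List.of_mem_zip (a := ab.1) (b := ab.2) hab).1 with h1 | h1
        · exact Or.inl h1.ge
        · exact Or.inl (hd.1 _ (List.mem_append_left _ h1)).le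
      · exact ih hc.2 hab ht

lemma exists_mem_zip {h N a : ℕ} {c : List ℕ} (ha : a ∈ h :: c) :
    ∃ b, (a, b) ∈ List.zip (h :: c) (c ++ [N]) := by
  induction c generalizing h with
  | nil => exact ⟨N, by simpa using ha⟩
  | cons d c ih =>
    rcases List.mem_cons.1 ha with rfl | ha
    · exact ⟨d, by simp⟩
    · obtain ⟨b, hb⟩ := ih ha
      exact ⟨b, by rw [List.cons_append, List.zip_cons_cons]; exact List.mem_cons_of_mem _ hb⟩

lemma getD_sampleSegment {N : ℕ} (y : Fin N → ℝ) {a b j : ℕ} (h : a + j < b) :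
    (sampleSegment y (a + 1) b).getD j 0 = samplePath y (a + j) := by
  simp [sampleSegment, samplePath, List.getD_eq_getElem?_getD, h]

section segmentSet
variable (L : ListEstimator) (lam : ℝ) {N : ℕ} (y : Fin N → ℝ)

/-- Up to one leading term, the segments run between consecutive elements of
`0, ψ_1, …, ψ_K, N`. -/
lemma exists_mem_zip_of_mem_segmentSet {s : List ℝ} (hs : s ∈ segmentSet L lam y) :
    ∃ a₀ a b : ℕ, (a, b) ∈ List.zip (0 :: L.candidates N y lam) (L.candidates N y lam ++ [N]) ∧
      a₀ ≤ a ∧ a ≤ a₀ + 1 ∧ s = sampleSegment y (a₀ + 1) b := by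
  obtain ⟨⟨a, b⟩, hab, rfl⟩ := hs
  have hpos := fun t ht => (L.mem_range N y lam t ht).1
  obtain ⟨d, l, hl⟩ := List.exists_cons_of_ne_nil
    (by simp : L.candidates N y lam ++ [N] ≠ [])
  rw [hl] at hab ⊢
  rw [List.zip_cons_cons, List.mem_cons] at hab
  simp only [List.zip_cons_cons, List.mem_cons]
  rcases hab with hab | hab
  · obtain ⟨rfl, rfl⟩ := Prod.mk.inj hab
    exact ⟨0, 0, b, Or.inl rfl, le_rfl, Nat.zero_le _, rfl⟩
  · have ha := hpos a (List.of_mem_zip hab).1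
    exact ⟨a - 1, a, b, Or.inr hab, by omega, by omega, by rw [Nat.sub_add_cancel ha]⟩

lemma exists_sampleSegment_mem_segmentSet {a b : ℕ}
    (hab : (a, b) ∈ List.zip (0 :: L.candidates N y lam) (L.candidates N y lam ++ [N])) :
    ∃ a₀, a₀ ≤ a ∧ a ≤ a₀ + 1 ∧ sampleSegment y (a₀ + 1) b ∈ segmentSet L lam y := by
  have hpos := fun t ht => (L.mem_range N y lam t ht).1
  unfold segmentSet
  obtain ⟨d, l, hl⟩ := List.exists_cons_of_ne_nil
    (by simp : L.candidates N y lam ++ [N] ≠ [])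
  rw [hl] at hab ⊢
  rw [List.zip_cons_cons, List.mem_cons] at hab
  rcases hab with hab | hab
  · obtain ⟨rfl, rfl⟩ := Prod.mk.inj hab
    exact ⟨0, le_rfl, Nat.zero_le _, (1, b), by simp, rfl⟩
  · have ha := hpos a (List.of_mem_zip hab).1
    exact ⟨a - 1, by omega, by omega, (a, b), by simp [hab], by rw [Nat.sub_add_cancel ha]⟩

lemma finite_segmentSet : (segmentSet L lam y).Finite := by
  have : segmentSet L lam y = (fun ab : ℕ × ℕ => sampleSegment y ab.1 ab.2) ''
      {ab | ab ∈ List.zip (1 :: L.candidates N y lam) (L.candidates N y lam ++ [N])} := by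
    ext s
    simp only [segmentSet, Set.mem_ofPred_eq, Set.mem_image, eq_comm]
  rw [this]
  exact (List.finite_toSet _).image _

lemma nonempty_segmentSet : (segmentSet L lam y).Nonempty := by
  obtain ⟨b, hb⟩ := exists_mem_zip (N := N) (c := L.candidates N y lam) (List.mem_cons_self (a := 1))
  exact ⟨_, _, hb, rfl⟩

end segmentSet

/-! ### Empirical measures of the segments -/

namespace PSEProcess
variable (p : PSEProcess)

/-- Windows of linear length that lie in segment `k` up to `o(n)` terms have empirical frequencies
close to the probabilities of segment `k`, uniformly in the position of the window. -/
lemma HasLinearHits.eventually_abs_empiricalMeasure_sub_le {p : PSEProcess}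
    {X : Fin (p.κ + 1) → ℕ → ℝ} (hX : p.HasLinearHits X) (k : Fin (p.κ + 1)) {δ : ℕ → ℝ}
    (hδ : Tendsto (fun n : ℕ => δ n / n) atTop (𝓝 0)) {m : ℕ → ℕ} {c : ℝ} (hc : 0 < c)
    (hm : ∀ᶠ n : ℕ in atTop, c * n ≤ m n) (u v : ℕ) (i : Fin (u + 1) → ℤ) {ε : ℝ} (hε : 0 < ε) :
    ∀ᶠ n : ℕ in atTop, ∀ (x : ℕ → ℝ) (a : ℕ),
      (∀ j < m n, x j = samplePath (p.sample n X) (a + j)) →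
      (p.boundary n k.castSucc : ℝ) ≤ a + δ n → (a + m n : ℝ) ≤ p.boundary n k.succ + δ n →
      |empiricalMeasure (m n) x (u + 1) (dyadicCube (u + 1) (v + 1) i) -
        processProb (p.marginal k) (u + 1) (dyadicCube (u + 1) (v + 1) i)| ≤ ε := by
  set B := dyadicCube (u + 1) (v + 1) i
  set q := processProb (p.marginal k) (u + 1) B
  have hq0 : 0 ≤ q := processProb_nonneg _ _ _
  have hq1 : q ≤ 1 := processProb_le_one _ _ _
  have hεc : 0 < ε * c := mul_pos hε hc
  obtain ⟨C, hC⟩ := hX u v i k (ε * c / 16) (by positivity)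
  have hδ' : ∀ᶠ n : ℕ in atTop, |δ n / n| < ε * c / 16 := by
    filter_upwards [Metric.tendsto_nhds.1 hδ (ε * c / 16) (by positivity)] with n hn
    rwa [Real.dist_eq, sub_zero] at hn
  have hlarge := fun b : ℝ => (tendsto_natCast_atTop_atTop (R := ℝ)).eventually_ge_atTop b
  filter_upwards [hm, hδ', hlarge (16 * C / (ε * c)), hlarge (2 * (u + 1) / c), hlarge 1]
    with n h1 h2 h3 h4 hn1 x a hx ha hb
  have hn0 : (0 : ℝ) < n := by linarith
  rw [abs_div, Nat.abs_cast, div_lt_iff₀ hn0] at h2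
  rw [div_le_iff₀ hεc] at h3
  rw [div_le_iff₀ hc] at h4
  have hum : u + 1 ≤ m n := by
    have : ((u + 1 : ℕ) : ℝ) ≤ m n := by
      push_cast
      have : (0 : ℝ) ≤ u := Nat.cast_nonneg u
      linarith
    exact_mod_cast this
  obtain ⟨r, hr⟩ := Nat.exists_eq_add_of_le hum
  have hr1 : m n - (u + 1) + 1 = r + 1 := by omega
  have hrn : c * n / 2 ≤ ((r + 1 : ℕ) : ℝ) := by
    have : (m n : ℝ) = u + 1 + r := by rw [hr]; push_cast; ring
    push_cast
    linarith
  set y := samplePath (p.sample n X)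
  set H := excess y (u + 1) B q with hH
  have hcount : hitCount x (u + 1) B (r + 1) =
      hitCount y (u + 1) B (a + (r + 1)) - hitCount y (u + 1) B a := by
    rw [hitCount, hitCount, hitCount, Finset.sum_range_add _ a, add_sub_cancel_left]
    refine Finset.sum_congr rfl fun i' hi' => ?_
    have hi' := Finset.mem_range.1 hi'
    congr 1
    funext j
    have hj := j.2
    rw [add_assoc]
    exact hx _ (by omega)
  have hr0 : (0 : ℝ) < ((r + 1 : ℕ) : ℝ) := by positivity
  have hemp : empiricalMeasure (m n) x (u + 1) B - q =
      (H (a + (r + 1)) - H a) / ((r + 1 : ℕ) : ℝ) := by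
    rw [empiricalMeasure_eq_hitCount_div x hum, hr1, hcount, hH, excess, excess]
    field_simp
    push_cast
    ring
  rw [hemp, abs_div, Nat.abs_cast, div_le_iff₀ hr0]
  -- projecting a time at distance at most `δ` from the segment onto the segment
  have hproj : ∀ t : ℕ, (p.boundary n k.castSucc : ℝ) ≤ t + δ n →
      (t : ℝ) ≤ p.boundary n k.succ + δ n →
      |H t - H (p.boundary n k.castSucc)| ≤ |δ n| + (ε * c / 16 * n + C) := by
    intro t ht1 ht2
    have hle : p.boundary n k.castSucc ≤ p.boundary n k.succ :=
      p.boundary_mono n Fin.castSucc_lt_succ.le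
    have hδn := le_abs_self (δ n)
    obtain ⟨t', h5, h6, h7⟩ : ∃ t', p.boundary n k.castSucc ≤ t' ∧ t' ≤ p.boundary n k.succ ∧
        |(t : ℝ) - t'| ≤ |δ n| := by
      rcases lt_or_ge t (p.boundary n k.castSucc) with h | h
      · refine ⟨_, le_rfl, hle, ?_⟩
        have : (t : ℝ) < p.boundary n k.castSucc := by exact_mod_cast h
        rw [abs_le]
        constructor <;> linarith [abs_nonneg (δ n)]
      rcases le_or_gt t (p.boundary n k.succ) with h' | h'
      · exact ⟨t, h, h', by simp⟩
      · refine ⟨_, hle, le_rfl, ?_⟩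
        have : (p.boundary n k.succ : ℝ) < t := by exact_mod_cast h'
        rw [abs_le]
        constructor <;> linarith [abs_nonneg (δ n)]
    have h8 := hC n t' h5 h6
    have h9 := abs_excess_sub_le y (u + 1) B hq0 hq1 t t'
    have := abs_sub_le (H t) (H t') (H (p.boundary n k.castSucc))
    linarith
  have hrm : ((r + 1 : ℕ) : ℝ) ≤ m n := by exact_mod_cast (by omega : r + 1 ≤ m n)
  have h5 := hproj a ha (by linarith [Nat.cast_nonneg (α := ℝ) (m n)])
  have h6 := hproj (a + (r + 1)) (by rw [Nat.cast_add]; linarith) (by rw [Nat.cast_add]; linarith)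
  have h7 := abs_sub_le (H (a + (r + 1))) (H (p.boundary n k.castSucc)) (H a)
  rw [abs_sub_comm (H (p.boundary n k.castSucc)) (H a)] at h7
  have h8 := mul_le_mul_of_nonneg_left hrn hε.le
  have h9 : 0 < ε * c * n := mul_pos hεc hn0
  linarith [mul_assoc ε c n]

/-- Such windows have empirical measures that are close to the law of segment `k` in the
distributional distance, again uniformly in the position. -/
lemma HasLinearHits.eventually_cubeDist_le {p : PSEProcess} {w : ℕ → ℝ} (hw : ∀ j, 0 < w j)
    (hws : Summable w)
    {X : Fin (p.κ + 1) → ℕ → ℝ} (hX : p.HasLinearHits X) (k : Fin (p.κ + 1)) {δ : ℕ → ℝ}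
    (hδ : Tendsto (fun n : ℕ => δ n / n) atTop (𝓝 0)) {m : ℕ → ℕ} {c : ℝ} (hc : 0 < c)
    (hm : ∀ᶠ n : ℕ in atTop, c * n ≤ m n) {ε : ℝ} (hε : 0 < ε) :
    ∀ᶠ n : ℕ in atTop, ∀ (x : ℕ → ℝ) (a : ℕ),
      (∀ j < m n, x j = samplePath (p.sample n X) (a + j)) →
      (p.boundary n k.castSucc : ℝ) ≤ a + δ n → (a + m n : ℝ) ≤ p.boundary n k.succ + δ n →
      cubeDist w (empiricalMeasure (m n) x) (processProb (p.marginal k)) ≤ ε := by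
  -- uniformity in `x` and `a` is convergence along the filter `l` of admissible triples
  let l : Filter (ℕ × (ℕ → ℝ) × ℕ) := comap Prod.fst atTop ⊓ 𝓟 {z |
    (∀ j < m z.1, z.2.1 j = samplePath (p.sample z.1 X) (z.2.2 + j)) ∧
    (p.boundary z.1 k.castSucc : ℝ) ≤ z.2.2 + δ z.1 ∧
    (z.2.2 + m z.1 : ℝ) ≤ p.boundary z.1 k.succ + δ z.1}
  have hl : Tendsto (fun z : ℕ × (ℕ → ℝ) × ℕ =>
      cubeDist w (empiricalMeasure (m z.1) z.2.1) (processProb (p.marginal k))) l (𝓝 0) := by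
    refine tendsto_cubeDist_processProb hw hws
      (fun z => isCubeSubprob_empiricalMeasure _ _) _ fun u v i => ?_
    refine Metric.tendsto_nhds.2 fun η hη => ?_
    refine eventually_inf_principal.2 (eventually_comap.2 ?_)
    filter_upwards [hX.eventually_abs_empiricalMeasure_sub_le k hδ hc hm u v i (half_pos hη)]
      with n hn z hz h
    subst hz
    rw [Real.dist_eq]
    linarith [hn z.2.1 z.2.2 h.1 h.2.1 h.2.2]
  have h := eventually_comap.1 (eventually_inf_principal.1 (hl.eventually (ge_mem_nhds hε)))
  filter_upwards [h] with n hn x a hx ha hb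
  exact hn (n, x, a) rfl ⟨hx, ha, hb⟩

/-- For all large `n` every segment produced by the list-estimator has an empirical measure close to
some stationary marginal, and every stationary marginal is approached by some segment. -/
lemma eventually_segmentSet_approx {w : ℕ → ℝ} (hw : ∀ j, 0 < w j) (hws : Summable w)
    {L : ListEstimator} {lam : ℝ} (hlam : 0 < lam)
    {X : Fin (p.κ + 1) → ℕ → ℝ} (hX : p.HasLinearHits X) {ψ : ℕ → Fin p.κ → ℕ}
    (hψ : ∀ᶠ n in atTop, ∀ k, ψ n k ∈ L.candidates (p.sampleLength n) (p.sample n X) lam)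
    (hψlim : ∀ k, Tendsto
        (fun n => |(ψ n k : ℝ) - p.changePoint n k| / (p.sampleLength n : ℝ)) atTop (𝓝 0))
    (hsep : ∀ᶠ n in atTop,
      List.IsChain (fun a b : ℕ => (a : ℝ) + lam * (p.sampleLength n : ℝ) ≤ (b : ℝ))
        (0 :: (L.candidates (p.sampleLength n) (p.sample n X) lam ++ [p.sampleLength n])))
    {m : ℕ → ℕ} (hmN : ∀ n, (m n : ℝ) ≤ lam * p.sampleLength n) {c : ℝ} (hc : 0 < c)
    (hm : ∀ᶠ n : ℕ in atTop, c * n ≤ m n) {ε : ℝ} (hε : 0 < ε) :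
    ∀ᶠ n : ℕ in atTop,
      (∀ s ∈ segmentSet L lam (p.sample n X), ∃ k, cubeDist w
        (empiricalMeasure (m n) fun i => s.getD i 0) (processProb (p.marginal k)) ≤ ε) ∧
      ∀ k, ∃ s ∈ segmentSet L lam (p.sample n X), cubeDist w
        (empiricalMeasure (m n) fun i => s.getD i 0) (processProb (p.marginal k)) ≤ ε := by
  have hlarge := fun b : ℝ => (tendsto_natCast_atTop_atTop (R := ℝ)).eventually_ge_atTop b
  set D : ℕ → ℝ := fun n => ∑ k, |(ψ n k : ℝ) - p.changePoint n k| with hDdef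
  have hD0 : ∀ n, 0 ≤ D n := fun n => Finset.sum_nonneg fun _ _ => abs_nonneg _
  have hDle : ∀ n k, |(ψ n k : ℝ) - p.changePoint n k| ≤ D n := fun n k =>
    Finset.single_le_sum (f := fun k => |(ψ n k : ℝ) - p.changePoint n k|)
      (fun _ _ => abs_nonneg _) (Finset.mem_univ k)
  have hNpos : ∀ᶠ n in atTop, (0 : ℝ) < p.sampleLength n :=
    p.eventually_sampleLength_pos.mono fun _ h => Nat.cast_pos.2 h
  have hDlim : Tendsto (fun n : ℕ => D n / n) atTop (𝓝 0) := by
    have h1 : Tendsto (fun n => D n / (p.sampleLength n : ℝ)) atTop (𝓝 0) := by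
      have := tendsto_finsetSum Finset.univ fun k _ => hψlim k
      simpa [hDdef, Finset.sum_div] using this
    refine squeeze_zero' (Eventually.of_forall fun n => div_nonneg (hD0 n) (Nat.cast_nonneg n))
      ?_ h1
    filter_upwards [hNpos] with n hn
    exact div_le_div_of_nonneg_left (hD0 n) hn (p.sampleLength_le n)
  have hδ : Tendsto (fun n : ℕ => (D n + 1) / n) atTop (𝓝 0) := by
    simpa [add_div] using hDlim.add tendsto_one_div_atTop_nhds_zero_nat
  have hDsmall : ∀ᶠ n : ℕ in atTop, D n / n < p.minSeparation / 4 :=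
    hDlim.eventually (gt_mem_nhds (by linarith [p.minSeparation_pos]))
  have hdist := eventually_all.2 fun k => hX.eventually_cubeDist_le hw hws k hδ hc hm hε
  filter_upwards [hψ, hsep, hNpos, hDsmall, hdist, hlarge 1, hlarge (2 / p.minSeparation)]
    with n hψ hsep hN hDs hdist hn1 hn2
  rw [div_lt_iff₀ (by linarith)] at hDs
  rw [div_le_iff₀ p.minSeparation_pos] at hn2
  set N := p.sampleLength n
  set l := L.candidates N (p.sample n X) lam
  have hlt : (0 :: (l ++ [N])).Pairwise (· < ·) := by
    refine List.isChain_iff_pairwise.1 (hsep.imp fun a b h => ?_)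
    have : (a : ℝ) < b := by linarith [mul_pos hlam hN]
    exact_mod_cast this
  have hlast : ∀ b ∈ l ++ [N], b ≤ N := by
    intro b hb
    rcases List.mem_append.1 hb with hb | hb
    · exact (L.mem_range _ _ _ b hb).2
    · exact (List.mem_singleton.1 hb).le
  -- a segment that lies within `D` of segment `k` has nearly the statistics of segment `k`
  have key : ∀ (k : Fin (p.κ + 1)) (a₀ a b : ℕ), (a, b) ∈ List.zip (0 :: l) (l ++ [N]) →
      a₀ ≤ a → a ≤ a₀ + 1 → (p.boundary n k.castSucc : ℝ) ≤ a + D n →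
      (b : ℝ) ≤ p.boundary n k.succ + D n →
      cubeDist w (empiricalMeasure (m n) fun i =>
        (sampleSegment (p.sample n X) (a₀ + 1) b).getD i 0) (processProb (p.marginal k)) ≤ ε := by
    intro k a₀ a b hab h1 h2 h3 h4
    have h5 := rel_of_mem_zip hsep hab
    simp only at h5
    have h6 : (a₀ : ℝ) ≤ a := by exact_mod_cast h1
    have h7 : (a : ℝ) ≤ a₀ + 1 := by exact_mod_cast h2
    have h8 : a₀ + m n ≤ b := by
      have : ((a₀ + m n : ℕ) : ℝ) ≤ b := by push_cast; linarith [hmN n]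
      exact_mod_cast this
    have h8' : (a₀ + m n : ℝ) ≤ b := by exact_mod_cast h8
    exact hdist k _ a₀ (fun j hj => getD_sampleSegment _ (by omega)) (by linarith) (by linarith)
  constructor
  · intro s hs
    obtain ⟨a₀, a, b, hab, h1, h2, rfl⟩ := exists_mem_zip_of_mem_segmentSet L lam _ hs
    obtain ⟨k, hk1, hk2⟩ := exists_castSucc_le_lt_succ
      (fun i => (p.boundary n i : ℝ)) (a := (a : ℝ) + D n)
      (by rw [p.boundary_zero, Nat.cast_zero]; linarith [hD0 n, Nat.cast_nonneg (α := ℝ) a])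
    refine ⟨k, key k a₀ a b hab h1 h2 hk1 ?_⟩
    induction k using Fin.lastCases with
    | last =>
      have : (b : ℝ) ≤ N := by exact_mod_cast hlast b (List.of_mem_zip hab).2
      rw [Fin.succ_last]
      change (b : ℝ) ≤ N + D n
      linarith [hD0 n]
    | cast j =>
      have hk2 := hk2.resolve_left (Fin.castSucc_lt_last j).ne
      rw [Fin.succ_castSucc] at hk2 ⊢
      have hj := abs_le.1 (hDle n j)
      change _ < (p.changePoint n j : ℝ) at hk2
      change _ ≤ (p.changePoint n j : ℝ) + _
      have h3 : (a : ℝ) < ψ n j := by linarith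
      have h3' : a < ψ n j := by exact_mod_cast h3
      have h4 : b ≤ ψ n j := (le_or_le_of_mem_zip hlt hab (hψ j)).resolve_left (not_le.2 h3')
      have h4' : (b : ℝ) ≤ ψ n j := by exact_mod_cast h4
      linarith
  · intro k
    obtain ⟨a, hal, ha⟩ : ∃ a ∈ 0 :: l, |(a : ℝ) - p.boundary n k.castSucc| ≤ D n := by
      induction k using Fin.cases with
      | zero =>
        exact ⟨0, List.mem_cons_self, by simpa [p.boundary_zero] using hD0 n⟩
      | succ j => exact ⟨ψ n j, List.mem_cons_of_mem _ (hψ j), hDle n j⟩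
    obtain ⟨b, hab⟩ := exists_mem_zip (N := N) hal
    obtain ⟨a₀, h1, h2, hs⟩ := exists_sampleSegment_mem_segmentSet L lam _ hab
    have ha' := abs_le.1 ha
    refine ⟨_, hs, key k a₀ a b hab h1 h2 (by linarith) ?_⟩
    induction k using Fin.lastCases with
    | last =>
      have : (b : ℝ) ≤ N := by exact_mod_cast hlast b (List.of_mem_zip hab).2
      rw [Fin.succ_last]
      change (b : ℝ) ≤ N + D n
      linarith [hD0 n]
    | cast j =>
      have hgap := p.boundary_gap (Fin.castSucc_lt_succ (i := j.castSucc)) n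
      rw [Fin.succ_castSucc] at hgap ⊢
      have hj := abs_le.1 (hDle n j)
      change _ < (p.changePoint n j : ℝ) - _ at hgap
      change _ ≤ (p.changePoint n j : ℝ) + _
      have h3 : (a : ℝ) < ψ n j := by linarith
      have h3' : a < ψ n j := by exact_mod_cast h3
      have h4 : b ≤ ψ n j := (le_or_le_of_mem_zip hlt hab (hψ j)).resolve_left (not_le.2 h3')
      have h4' : (b : ℝ) ≤ ψ n j := by exact_mod_cast h4
      linarith

end PSEProcess

/-! ### Consistency of the estimator of the distance -/

theorem ae_tendsto_deltaEstimate (L : ListEstimator) (hL : L.IsConsistent) (hS : L.IsSeparated)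
    (w : ℕ → ℝ) (hw : ∀ j, 0 < w j) (hws : Summable w) (p p' : PSEProcess)
    (P : Measure ((Fin (p.κ + 1) → ℕ → ℝ) × (Fin (p'.κ + 1) → ℕ → ℝ)))
    (hP : P.map Prod.fst = p.ρ) (hP' : P.map Prod.snd = p'.ρ) (lam : ℝ) (hlam : 0 < lam)
    (hle : lam ≤ min p.minSeparation p'.minSeparation) :
    ∀ᵐ Z ∂P, Tendsto
      (fun n => deltaEstimate w L lam (p.sample n Z.1) (p'.sample n Z.2)) atTop
      (𝓝 (classDist w ⟦p⟧ ⟦p'⟧)) := by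
  have hp := hle.trans (min_le_left _ _)
  have hp' := hle.trans (min_le_right _ _)
  have hae := (p.ae_hasLinearHits.and (hL p lam hlam hp)).and (L.isSeparated_iff.1 hS p lam hlam hp)
  have hae' := (p'.ae_hasLinearHits.and (hL p' lam hlam hp')).and (L.isSeparated_iff.1 hS p' lam hlam hp')
  rw [← hP] at hae
  rw [← hP'] at hae'
  filter_upwards [ae_of_ae_map measurable_fst.aemeasurable hae,
    ae_of_ae_map measurable_snd.aemeasurable hae'] with Z hZ hZ'
  obtain ⟨⟨hX, ψ, hψ, hψlim⟩, hsep⟩ := hZ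
  obtain ⟨⟨hX', ψ', hψ', hψlim'⟩, hsep'⟩ := hZ'
  set m : ℕ → ℕ := fun n => ⌊min (lam * p.sampleLength n) (lam * p'.sampleLength n)⌋₊
  have hm0 : ∀ n, 0 ≤ min (lam * (p.sampleLength n : ℝ)) (lam * p'.sampleLength n) := fun n =>
    le_min (by positivity) (by positivity)
  have hm1 : ∀ n, (m n : ℝ) ≤ lam * p.sampleLength n := fun n =>
    (Nat.floor_le (hm0 n)).trans (min_le_left _ _)
  have hm2 : ∀ n, (m n : ℝ) ≤ lam * p'.sampleLength n := fun n =>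
    (Nat.floor_le (hm0 n)).trans (min_le_right _ _)
  obtain ⟨c, hc, hm⟩ : ∃ c : ℝ, 0 < c ∧ ∀ᶠ n : ℕ in atTop, c * n ≤ m n := by
    set c := min (lam * (p.θ (Fin.last _) / 2)) (lam * (p'.θ (Fin.last _) / 2))
    have hc : 0 < c := lt_min (mul_pos hlam (half_pos p.θ_last_pos))
      (mul_pos hlam (half_pos p'.θ_last_pos))
    refine ⟨c / 2, half_pos hc, ?_⟩
    filter_upwards [p.eventually_mul_le_sampleLength, p'.eventually_mul_le_sampleLength,
      (tendsto_natCast_atTop_atTop (R := ℝ)).eventually_ge_atTop (2 / c)] with n h1 h2 h3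
    rw [div_le_iff₀ hc] at h3
    have h4 : c * n ≤ min (lam * (p.sampleLength n : ℝ)) (lam * p'.sampleLength n) := by
      refine le_min ?_ ?_
      · calc c * n ≤ lam * (p.θ (Fin.last _) / 2) * n := by gcongr; exact min_le_left _ _
          _ = lam * (p.θ (Fin.last _) / 2 * n) := by ring
          _ ≤ _ := by gcongr
      · calc c * n ≤ lam * (p'.θ (Fin.last _) / 2) * n := by gcongr; exact min_le_right _ _
          _ = lam * (p'.θ (Fin.last _) / 2 * n) := by ring
          _ ≤ _ := by gcongr
    have h5 := Nat.lt_floor_add_one (min (lam * (p.sampleLength n : ℝ)) (lam * p'.sampleLength n))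
    change _ < (m n : ℝ) + 1 at h5
    linarith
  refine Metric.tendsto_nhds.2 fun ε hε => ?_
  have hε8 : 0 < ε / 8 := by positivity
  filter_upwards [p.eventually_segmentSet_approx hw hws hlam hX (hψ.mono fun _ h => h.2) hψlim hsep
      hm1 hc hm hε8,
    p'.eventually_segmentSet_approx hw hws hlam hX' (hψ'.mono fun _ h => h.2) hψlim' hsep'
      hm2 hc hm hε8] with n hn hn'
  let R : List ℝ → Measure (ℕ → ℝ) → Prop := fun s μ => IsProbabilityMeasure μ ∧
    cubeDist w (empiricalMeasure (m n) fun i => s.getD i 0) (processProb μ) ≤ ε / 8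
  have hR : ∀ s s' μ μ', R s μ → R s' μ' →
      |empiricalDist w (m n) s s' - distributionalDist w μ μ'| ≤ ε / 4 := by
    rintro s s' μ μ' ⟨_, h1⟩ ⟨_, h2⟩
    have := abs_cubeDist_sub_le hw hws (isCubeSubprob_empiricalMeasure (m n) fun i => s.getD i 0)
      (isCubeSubprob_empiricalMeasure (m n) fun i => s'.getD i 0)
      (isCubeSubprob_processProb μ) (isCubeSubprob_processProb μ')
    rw [empiricalDist, distributionalDist]
    linarith
  have hSM : ∀ s ∈ segmentSet L lam (p.sample n Z.1), ∃ μ ∈ p.marginals, R s μ := fun s hs =>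
    have ⟨k, hk⟩ := hn.1 s hs
    ⟨p.marginal k, ⟨k, rfl⟩, inferInstance, hk⟩
  have hMS : ∀ μ ∈ p.marginals, ∃ s ∈ segmentSet L lam (p.sample n Z.1), R s μ := by
    rintro _ ⟨k, rfl⟩
    obtain ⟨s, hs, h⟩ := hn.2 k
    exact ⟨s, hs, inferInstanceAs (IsProbabilityMeasure (p.marginal k)), h⟩
  have hSM' : ∀ s ∈ segmentSet L lam (p'.sample n Z.2), ∃ μ ∈ p'.marginals, R s μ := fun s hs =>
    have ⟨k, hk⟩ := hn'.1 s hs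
    ⟨p'.marginal k, ⟨k, rfl⟩, inferInstance, hk⟩
  have hMS' : ∀ μ ∈ p'.marginals, ∃ s ∈ segmentSet L lam (p'.sample n Z.2), R s μ := by
    rintro _ ⟨k, rfl⟩
    obtain ⟨s, hs, h⟩ := hn'.2 k
    exact ⟨s, hs, inferInstanceAs (IsProbabilityMeasure (p'.marginal k)), h⟩
  have hne := nonempty_segmentSet L lam (p.sample n Z.1)
  have hne' := nonempty_segmentSet L lam (p'.sample n Z.2)
  have hfin := finite_segmentSet L lam (p.sample n Z.1)
  have hfin' := finite_segmentSet L lam (p'.sample n Z.2)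
  have hMne : p.marginals.Nonempty := Set.range_nonempty _
  have hMne' : p'.marginals.Nonempty := Set.range_nonempty _
  have hMfin : p.marginals.Finite := Set.finite_range _
  have hMfin' : p'.marginals.Finite := Set.finite_range _
  have e1 := abs_maxMin_sub_le hne hfin hne' hfin' hMne hMfin hMne' hMfin' hSM hMS hSM' hMS'
    (f := empiricalDist w (m n)) (g := distributionalDist w) (ε := ε / 4)
    fun s s' μ μ' h h' => hR s s' μ μ' h h'
  have e2 := abs_maxMin_sub_le hne' hfin' hne hfin hMne' hMfin' hMne hMfin hSM' hMS' hSM hMS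
    (f := empiricalDist w (m n)) (g := distributionalDist w) (ε := ε / 4)
    fun s s' μ μ' h h' => hR s s' μ μ' h h'
  change |(maxMin (empiricalDist w (m n)) (segmentSet L lam (p.sample n Z.1))
      (segmentSet L lam (p'.sample n Z.2)) + maxMin (empiricalDist w (m n))
      (segmentSet L lam (p'.sample n Z.2)) (segmentSet L lam (p.sample n Z.1))) -
    (maxMin (distributionalDist w) p.marginals p'.marginals +
      maxMin (distributionalDist w) p'.marginals p.marginals)| < ε
  rw [abs_le] at e1 e2
  rw [abs_lt]
  constructor <;> linarith

/-! ### The bend of the hit counts between candidate change points -/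

/-- The largest second difference, divided by `N`, of the hit count of `B` over the symmetric
intervals `[c - h, c + h]` in `[0, N]` whose interior contains no element of `S`. It is small if the
hit count is nearly affine between any two consecutive elements of `S`. -/
noncomputable def bend (x : ℕ → ℝ) (N : ℕ) (S : Finset ℕ) (u : ℕ) (B : Set (Fin u → ℝ)) : ℝ :=
  sSup {r | ∃ c h : ℕ, h ≤ c ∧ c + h ≤ N ∧ (∀ s ∈ S, s ≤ c - h ∨ c + h ≤ s) ∧
    r = |hitCount x u B (c + h) - 2 * hitCount x u B c + hitCount x u B (c - h)|} / N

lemma hitCount_second_diff (x : ℕ → ℝ) (u : ℕ) (B : Set (Fin u → ℝ)) (q : ℝ) {c h : ℕ}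
    (hc : h ≤ c) :
    hitCount x u B (c + h) - 2 * hitCount x u B c + hitCount x u B (c - h) =
      excess x u B q (c + h) - 2 * excess x u B q c + excess x u B q (c - h) := by
  rw [excess, excess, excess, Nat.cast_sub hc]
  push_cast
  ring

lemma hitCount_second_diff_le (x : ℕ → ℝ) (u : ℕ) (B : Set (Fin u → ℝ)) {N c h : ℕ}
    (hc : h ≤ c) (hN : c + h ≤ N) :
    |hitCount x u B (c + h) - 2 * hitCount x u B c + hitCount x u B (c - h)| ≤ 2 * N := by
  rw [hitCount_second_diff x u B 0 hc]
  have h1 := abs_excess_sub_le x u B le_rfl zero_le_one (c + h) c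
  have h2 := abs_excess_sub_le x u B le_rfl zero_le_one c (c - h)
  rw [Nat.cast_add, add_sub_cancel_left, Nat.abs_cast] at h1
  rw [Nat.cast_sub hc, sub_sub_cancel, Nat.abs_cast] at h2
  have h3 : (h : ℝ) ≤ N := by exact_mod_cast (Nat.le_add_left h c).trans hN
  rw [abs_le] at h1 h2 ⊢
  constructor <;> linarith [h1.1, h1.2, h2.1, h2.2]

lemma bend_nonneg (x : ℕ → ℝ) (N : ℕ) (S : Finset ℕ) (u : ℕ) (B : Set (Fin u → ℝ)) :
    0 ≤ bend x N S u B := by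
  refine div_nonneg (Real.sSup_nonneg ?_) (Nat.cast_nonneg N)
  rintro _ ⟨c, h, -, -, -, rfl⟩
  exact abs_nonneg _

lemma bend_le {x : ℕ → ℝ} {N : ℕ} {S : Finset ℕ} {u : ℕ} {B : Set (Fin u → ℝ)} {b : ℝ}
    (hb : 0 ≤ b)
    (h : ∀ c h : ℕ, h ≤ c → c + h ≤ N → (∀ s ∈ S, s ≤ c - h ∨ c + h ≤ s) →
      |hitCount x u B (c + h) - 2 * hitCount x u B c + hitCount x u B (c - h)| ≤ b * N) :
    bend x N S u B ≤ b := by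
  refine div_le_of_le_mul₀ (Nat.cast_nonneg N) hb (Real.sSup_le ?_ (by positivity))
  rintro _ ⟨c, h', h1, h2, h3, rfl⟩
  exact h c h' h1 h2 h3

lemma bend_le_two (x : ℕ → ℝ) (N : ℕ) (S : Finset ℕ) (u : ℕ) (B : Set (Fin u → ℝ)) :
    bend x N S u B ≤ 2 :=
  bend_le zero_le_two fun _ _ h1 h2 _ => hitCount_second_diff_le x u B h1 h2

lemma second_diff_le_bend_mul {x : ℕ → ℝ} {N : ℕ} (hN : 0 < N) {S : Finset ℕ} {u : ℕ}
    {B : Set (Fin u → ℝ)} {c h : ℕ} (h1 : h ≤ c) (h2 : c + h ≤ N)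
    (h3 : ∀ s ∈ S, s ≤ c - h ∨ c + h ≤ s) :
    |hitCount x u B (c + h) - 2 * hitCount x u B c + hitCount x u B (c - h)| ≤
      bend x N S u B * N := by
  have hN' : (N : ℝ) ≠ 0 := by positivity
  rw [bend, div_mul_cancel₀ _ hN']
  refine le_csSup ⟨2 * N, ?_⟩ ⟨c, h, h1, h2, h3, rfl⟩
  rintro _ ⟨c, h, h1, h2, -, rfl⟩
  exact hitCount_second_diff_le x u B h1 h2

/-- An enumeration of the triples `(u, v, i)` that index the dyadic cubes of all dimensions and side
lengths. -/
noncomputable def cubeEnum : ℕ → (u : ℕ) × ℕ × (Fin (u + 1) → ℤ) :=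
  (exists_surjective_nat _).choose

lemma cubeEnum_surjective : Function.Surjective cubeEnum := (exists_surjective_nat _).choose_spec

/-- The weighted sum of the bends over all dyadic cubes. -/
noncomputable def totalBend (x : ℕ → ℝ) (N : ℕ) (S : Finset ℕ) : ℝ :=
  ∑' j : ℕ, (1 / 2 : ℝ) ^ j * bend x N S ((cubeEnum j).1 + 1)
    (dyadicCube ((cubeEnum j).1 + 1) ((cubeEnum j).2.1 + 1) (cubeEnum j).2.2)

lemma norm_weight_mul_bend_le (x : ℕ → ℝ) (N : ℕ) (S : Finset ℕ) (j u : ℕ)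
    (B : Set (Fin u → ℝ)) : ‖(1 / 2 : ℝ) ^ j * bend x N S u B‖ ≤ (1 / 2 : ℝ) ^ j * 2 := by
  rw [Real.norm_of_nonneg (mul_nonneg (by positivity) (bend_nonneg x N S u B))]
  exact mul_le_mul_of_nonneg_left (bend_le_two x N S u B) (by positivity)

lemma totalBend_nonneg (x : ℕ → ℝ) (N : ℕ) (S : Finset ℕ) : 0 ≤ totalBend x N S :=
  tsum_nonneg fun _ => mul_nonneg (by positivity) (bend_nonneg _ _ _ _ _)

lemma tendsto_totalBend_zero {x : ℕ → ℕ → ℝ} {N : ℕ → ℕ} {S : ℕ → Finset ℕ}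
    (h : ∀ u v i, Tendsto (fun n => bend (x n) (N n) (S n) (u + 1) (dyadicCube (u + 1) (v + 1) i))
      atTop (𝓝 0)) : Tendsto (fun n => totalBend (x n) (N n) (S n)) atTop (𝓝 0) := by
  have := tendsto_tsum_of_dominated_convergence (𝓕 := atTop)
    (f := fun n j => (1 / 2 : ℝ) ^ j * bend (x n) (N n) (S n) ((cubeEnum j).1 + 1)
      (dyadicCube ((cubeEnum j).1 + 1) ((cubeEnum j).2.1 + 1) (cubeEnum j).2.2))
    (g := fun _ => (0 : ℝ)) (bound := fun j => (1 / 2 : ℝ) ^ j * 2)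
    (summable_geometric_two.mul_right 2)
    (fun j => by simpa using (h _ _ _).const_mul ((1 / 2 : ℝ) ^ j))
    (Eventually.of_forall fun n j => norm_weight_mul_bend_le _ _ _ _ _ _)
  simpa [totalBend] using this

lemma tendsto_bend_zero {x : ℕ → ℕ → ℝ} {N : ℕ → ℕ} {S : ℕ → Finset ℕ}
    (h : Tendsto (fun n => totalBend (x n) (N n) (S n)) atTop (𝓝 0)) (u v : ℕ)
    (i : Fin (u + 1) → ℤ) :
    Tendsto (fun n => bend (x n) (N n) (S n) (u + 1) (dyadicCube (u + 1) (v + 1) i))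
      atTop (𝓝 0) := by
  obtain ⟨j, hj⟩ := cubeEnum_surjective ⟨u, v, i⟩
  refine squeeze_zero (fun n => bend_nonneg _ _ _ _ _) (fun n => ?_)
    (by simpa using h.const_mul ((2 : ℝ) ^ j))
  have hs : Summable fun j : ℕ => (1 / 2 : ℝ) ^ j * bend (x n) (N n) (S n) ((cubeEnum j).1 + 1)
      (dyadicCube ((cubeEnum j).1 + 1) ((cubeEnum j).2.1 + 1) (cubeEnum j).2.2) :=
    Summable.of_norm_bounded (summable_geometric_two.mul_right 2)
      fun j => norm_weight_mul_bend_le _ _ _ _ _ _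
  have h1 := hs.le_tsum j fun _ _ => mul_nonneg (by positivity) (bend_nonneg _ _ _ _ _)
  rw [hj] at h1
  change _ ≤ totalBend (x n) (N n) (S n) at h1
  have h2 := mul_le_mul_of_nonneg_left h1 (by positivity : (0 : ℝ) ≤ 2 ^ j)
  rwa [← mul_assoc, ← mul_pow, mul_one_div_cancel two_ne_zero, one_pow, one_mul] at h2

/-! ### Minimizing the bend over separated sets -/

/-- Distinct elements of `S ∪ {0, N}` are at least `λ N` apart. -/
def IsSeparatedIn (N : ℕ) (lam : ℝ) (S : Finset ℕ) : Prop :=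
  ∀ a ∈ insert 0 (insert N S), ∀ b ∈ insert 0 (insert N S), a < b → (a : ℝ) + lam * N ≤ b

open Classical in
/-- The finite set of all subsets of `{1, …, N - 1}` that are `λ`-separated in `[0, N]`. -/
noncomputable def separatedSets (N : ℕ) (lam : ℝ) : Finset (Finset ℕ) :=
  (Finset.Ioo 0 N).powerset.filter (IsSeparatedIn N lam)

lemma mem_separatedSets {N : ℕ} {lam : ℝ} {S : Finset ℕ} :
    S ∈ separatedSets N lam ↔ S ⊆ Finset.Ioo 0 N ∧ IsSeparatedIn N lam S := by
  classical
  simp [separatedSets]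

/-- A `λ`-separated set with the smallest total bend; the empty set if there is no `λ`-separated
set. -/
noncomputable def minBendSet (x : ℕ → ℝ) (N : ℕ) (lam : ℝ) : Finset ℕ :=
  if h : (separatedSets N lam).Nonempty then
    (Finset.exists_min_image (separatedSets N lam) (totalBend x N) h).choose
  else ∅

lemma minBendSet_spec (x : ℕ → ℝ) {N : ℕ} {lam : ℝ} {T : Finset ℕ}
    (hT : T ∈ separatedSets N lam) : minBendSet x N lam ∈ separatedSets N lam ∧
      totalBend x N (minBendSet x N lam) ≤ totalBend x N T := by
  have h : (separatedSets N lam).Nonempty := ⟨T, hT⟩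
  rw [minBendSet, dif_pos h]
  have hs := (Finset.exists_min_image (separatedSets N lam) (totalBend x N) h).choose_spec
  exact ⟨hs.1, hs.2 T hT⟩

lemma minBendSet_subset (x : ℕ → ℝ) (N : ℕ) (lam : ℝ) :
    minBendSet x N lam ⊆ Finset.Ioo 0 N := by
  by_cases h : (separatedSets N lam).Nonempty
  · obtain ⟨T, hT⟩ := h
    exact (mem_separatedSets.1 (minBendSet_spec x hT).1).1
  · rw [minBendSet, dif_neg h]
    exact Finset.empty_subset _

/-- The list-estimator whose candidates are a `λ`-separated set of smallest total bend. -/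
noncomputable def minBendEstimator : ListEstimator where
  candidates N y lam := (minBendSet (samplePath y) N lam).sort
  sorted N y lam := (Finset.sortedLT_sort _).pairwise
  mem_range N y lam t ht := by
    have := Finset.mem_Ioo.1 (minBendSet_subset _ _ _ ((Finset.mem_sort _).1 ht))
    omega

lemma isChain_sort_of_mem_separatedSets {N : ℕ} (hN : 0 < N) {lam : ℝ} {S : Finset ℕ}
    (hS : S ∈ separatedSets N lam) :
    List.IsChain (fun a b : ℕ => (a : ℝ) + lam * N ≤ b) (0 :: (S.sort ++ [N])) := by
  obtain ⟨hsub, hsep⟩ := mem_separatedSets.1 hS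
  have hsub : ∀ s ∈ S, 0 < s ∧ s < N := fun s hs =>
    Finset.mem_Ioo.1 (hsub hs)
  have hlt : (0 :: (S.sort ++ [N])).Pairwise (· < ·) := by
    refine List.pairwise_cons.2 ⟨fun t ht => ?_, List.pairwise_append.2
      ⟨(Finset.sortedLT_sort _).pairwise, List.pairwise_singleton _ _, fun a ha b hb => ?_⟩⟩
    · rcases List.mem_append.1 ht with ht | ht
      · exact (hsub t ((Finset.mem_sort _).1 ht)).1
      · rwa [List.mem_singleton.1 ht]
    · rw [List.mem_singleton.1 hb]
      exact (hsub a ((Finset.mem_sort _).1 ha)).2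
  have hmem : ∀ t ∈ 0 :: (S.sort ++ [N]), t ∈ insert 0 (insert N S) := by
    intro t ht
    simp only [List.mem_cons, List.mem_append, Finset.mem_sort, List.not_mem_nil, or_false] at ht
    simp only [Finset.mem_insert]
    tauto
  exact (hlt.imp_of_mem fun ha hb hab => hsep _ (hmem _ ha) _ (hmem _ hb) hab).isChain

namespace PSEProcess
variable (p : PSEProcess)

/-- The set of true change points in the `n`-th sample. -/
noncomputable def changePointSet (n : ℕ) : Finset ℕ := Finset.univ.image (p.changePoint n)

lemma eventually_changePointSet_mem_separatedSets {lam : ℝ}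
    (hle : lam ≤ p.minSeparation) :
    ∀ᶠ n in atTop, p.changePointSet n ∈ separatedSets (p.sampleLength n) lam := by
  have hsep := p.minSeparation_pos
  have hθ : 0 < 1 - p.θ (Fin.last _) := sub_pos.2 p.θ_last_lt_one
  have hlarge := fun b : ℝ => (tendsto_natCast_atTop_atTop (R := ℝ)).eventually_ge_atTop b
  filter_upwards [hlarge (1 / p.minSeparation),
    hlarge (1 / (p.minSeparation * (1 - p.θ (Fin.last _))))] with n h1 h2
  rw [div_le_iff₀ hsep] at h1
  rw [div_le_iff₀ (mul_pos hsep hθ)] at h2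
  have hlt : ∀ {a b : Fin (p.κ + 2)}, a < b → p.boundary n a < p.boundary n b := by
    intro a b hab
    have := p.boundary_gap hab n
    have h3 : (p.boundary n a : ℝ) < p.boundary n b := by linarith
    exact_mod_cast h3
  refine mem_separatedSets.2 ⟨fun t ht => ?_, ?_⟩
  · obtain ⟨k, -, rfl⟩ := Finset.mem_image.1 ht
    refine Finset.mem_Ioo.2 ⟨?_, hlt (Fin.castSucc_lt_last k.succ)⟩
    have := hlt (a := 0) (b := k.succ.castSucc) (by
      rw [← Fin.castSucc_zero, Fin.castSucc_lt_castSucc_iff]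
      exact Fin.succ_pos k)
    rwa [p.boundary_zero] at this
  · have hmem : ∀ t ∈ insert 0 (insert (p.sampleLength n) (p.changePointSet n)),
        ∃ i, p.boundary n i = t := by
      intro t ht
      rcases Finset.mem_insert.1 ht with rfl | ht
      · exact ⟨0, p.boundary_zero n⟩
      rcases Finset.mem_insert.1 ht with rfl | ht
      · exact ⟨Fin.last _, rfl⟩
      · obtain ⟨k, -, rfl⟩ := Finset.mem_image.1 ht
        exact ⟨_, rfl⟩
    intro a ha b hb hab
    obtain ⟨i, rfl⟩ := hmem a ha
    obtain ⟨j, rfl⟩ := hmem b hb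
    have hij : i < j := by
      by_contra! h
      exact absurd (p.boundary_mono n h) (not_le.2 hab)
    have h3 := p.boundary_gap hij n
    -- `θ_{κ+1} < 1` leaves room for the rounding of the change points
    have h4 : lam * p.sampleLength n ≤ p.minSeparation * (n * p.θ (Fin.last _)) :=
      mul_le_mul hle (p.boundary_le_mul n _) (Nat.cast_nonneg _) hsep.le
    linarith

/-- The true change points leave no bend, since the hit counts are nearly affine on each
stationary segment. -/
lemma HasLinearHits.tendsto_bend_changePointSet {p : PSEProcess} {X : Fin (p.κ + 1) → ℕ → ℝ}
    (hX : p.HasLinearHits X) (u v : ℕ) (i : Fin (u + 1) → ℤ) :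
    Tendsto (fun n => bend (samplePath (p.sample n X)) (p.sampleLength n) (p.changePointSet n)
      (u + 1) (dyadicCube (u + 1) (v + 1) i)) atTop (𝓝 0) := by
  set B := dyadicCube (u + 1) (v + 1) i
  have hθ := p.θ_last_pos
  have hseg : ∀ η : ℝ, 0 < η → ∀ k : Fin (p.κ + 1), ∀ᶠ n in atTop, ∀ c h : ℕ, h ≤ c →
      p.boundary n k.castSucc ≤ c - h → c + h ≤ p.boundary n k.succ →
      |hitCount (samplePath (p.sample n X)) (u + 1) B (c + h) -
        2 * hitCount (samplePath (p.sample n X)) (u + 1) B c +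
        hitCount (samplePath (p.sample n X)) (u + 1) B (c - h)| ≤ η * p.sampleLength n := by
    intro η hη k
    obtain ⟨C, hC⟩ := hX u v i k (η * p.θ (Fin.last _) / 16) (by positivity)
    filter_upwards [p.eventually_mul_le_sampleLength,
      (tendsto_natCast_atTop_atTop (R := ℝ)).eventually_ge_atTop
        (16 * C / (η * p.θ (Fin.last _)))] with n hN hn c h h1 h2 h3
    rw [div_le_iff₀ (mul_pos hη hθ)] at hn
    rw [hitCount_second_diff _ _ _ (processProb (p.marginal k) (u + 1) B) h1]
    have e1 := abs_le.1 (hC n (c + h) (by omega) (by omega))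
    have e2 := abs_le.1 (hC n c (by omega) (by omega))
    have e3 := abs_le.1 (hC n (c - h) (by omega) (by omega))
    have e4 := mul_le_mul_of_nonneg_left hN hη.le
    rw [abs_le]
    constructor <;> linarith [e1.1, e1.2, e2.1, e2.2, e3.1, e3.2]
  refine Metric.tendsto_nhds.2 fun η hη => ?_
  filter_upwards [eventually_all.2 (hseg (η / 2) (half_pos hη))] with n hn
  rw [Real.dist_eq, sub_zero, abs_of_nonneg (bend_nonneg _ _ _ _ _)]
  refine (bend_le (half_pos hη).le fun c h h1 h2 h3 => ?_).trans_lt (half_lt_self hη)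
  obtain ⟨k, hk1, hk2⟩ := exists_castSucc_le_lt_succ (p.boundary n) (a := c - h)
    (by rw [p.boundary_zero]; exact Nat.zero_le _)
  refine hn k c h h1 hk1 ?_
  induction k using Fin.lastCases with
  | last => rw [Fin.succ_last]; exact h2
  | cast j =>
    have hk2 := hk2.resolve_left (Fin.castSucc_lt_last j).ne
    rw [Fin.succ_castSucc] at hk2 ⊢
    exact (h3 (p.changePoint n j) (Finset.mem_image_of_mem _ (Finset.mem_univ j))).resolve_left
      (not_le.2 hk2)

/-- Sets without asymptotic bend come close to every change point: the hit count of a cube that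
separates the laws before and after the change point has a large second difference there. -/
lemma HasLinearHits.eventually_exists_near {p : PSEProcess} {X : Fin (p.κ + 1) → ℕ → ℝ}
    (hX : p.HasLinearHits X) {S : ℕ → Finset ℕ}
    (hS : ∀ u v i, Tendsto (fun n => bend (samplePath (p.sample n X)) (p.sampleLength n) (S n)
      (u + 1) (dyadicCube (u + 1) (v + 1) i)) atTop (𝓝 0)) (k : Fin p.κ) {ε : ℝ} (hε : 0 < ε) :
    ∀ᶠ n : ℕ in atTop, ∃ s ∈ S n, |(s : ℝ) - p.changePoint n k| ≤ ε * n := by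
  wlog hεs : ε ≤ p.minSeparation / 2 generalizing ε with H
  · filter_upwards [H (half_pos p.minSeparation_pos) le_rfl] with n ⟨s, hs, h⟩
    refine ⟨s, hs, h.trans ?_⟩
    gcongr
    exact (not_le.1 hεs).le
  obtain ⟨u, v, i, hne⟩ : ∃ (u v : ℕ) (i : Fin (u + 1) → ℤ),
      processProb (p.marginal k.castSucc) (u + 1) (dyadicCube (u + 1) (v + 1) i) ≠
      processProb (p.marginal k.succ) (u + 1) (dyadicCube (u + 1) (v + 1) i) := by
    by_contra! h
    exact p.consecutive_ne k (process_eq_of_processProb_dyadicCube (μ := p.marginal k.castSucc)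
      (ν := p.marginal k.succ) h)
  set B := dyadicCube (u + 1) (v + 1) i
  set q₁ := processProb (p.marginal k.castSucc) (u + 1) B
  set q₂ := processProb (p.marginal k.succ) (u + 1) B
  set d := |q₂ - q₁|
  have hd : 0 < d := abs_pos.2 (sub_ne_zero.2 hne.symm)
  have hη : 0 < ε * d / 8 := by positivity
  obtain ⟨C₁, hC₁⟩ := hX u v i k.castSucc _ hη
  obtain ⟨C₂, hC₂⟩ := hX u v i k.succ _ hη
  have hlarge := fun b : ℝ => (tendsto_natCast_atTop_atTop (R := ℝ)).eventually_gt_atTop b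
  filter_upwards [(hS u v i).eventually (gt_mem_nhds hη), p.eventually_mul_le_sampleLength,
    hlarge 0, hlarge (2 / p.minSeparation), hlarge (2 * (2 * C₁ + C₂ + d) / (ε * d))]
    with n hb hN hn0 hn1 hn2
  rw [div_lt_iff₀ p.minSeparation_pos] at hn1
  rw [div_lt_iff₀ (mul_pos hε hd)] at hn2
  have hNpos : 0 < p.sampleLength n := by
    have : (0 : ℝ) < p.sampleLength n :=
      (mul_pos (half_pos p.θ_last_pos) hn0).trans_le hN
    exact_mod_cast this
  by_contra! hcon
  set τ := p.changePoint n k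
  set h := ⌊ε * n⌋₊
  have hh1 : (h : ℝ) ≤ ε * n := Nat.floor_le (by positivity)
  have hh2 : ε * n < h + 1 := Nat.lt_floor_add_one _
  have hεn : ε * n ≤ p.minSeparation / 2 * n := by gcongr
  have hgap1 := p.boundary_gap (Fin.castSucc_lt_succ (i := k.castSucc)) n
  have hgap2 := p.boundary_gap (Fin.castSucc_lt_succ (i := k.succ)) n
  rw [Fin.succ_castSucc] at hgap1
  have hprev : p.boundary n k.castSucc.castSucc + h ≤ τ := by
    have : (p.boundary n k.castSucc.castSucc : ℝ) + h ≤ p.boundary n k.succ.castSucc := by linarith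
    exact_mod_cast this
  have hnext : τ + h ≤ p.boundary n k.succ.succ := by
    have : (p.boundary n k.succ.castSucc : ℝ) + h ≤ p.boundary n k.succ.succ := by linarith
    exact_mod_cast this
  have hhτ : h ≤ τ := (Nat.le_add_left _ _).trans hprev
  have hS' : ∀ s ∈ S n, s ≤ τ - h ∨ τ + h ≤ s := by
    intro s hs
    have h1 := hcon s hs
    rcases lt_abs.1 h1 with h2 | h2
    · right
      have : ((τ + h : ℕ) : ℝ) ≤ s := by push_cast; linarith
      exact_mod_cast this
    · left
      have : ((s + h : ℕ) : ℝ) ≤ τ := by push_cast; linarith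
      have : s + h ≤ τ := by exact_mod_cast this
      omega
  have hmain := second_diff_le_bend_mul (x := samplePath (p.sample n X)) (B := B) hNpos hhτ
    (hnext.trans (p.boundary_le_sampleLength n _)) hS'
  set F := hitCount (samplePath (p.sample n X)) (u + 1) B
  have hbase : p.boundary n k.succ.castSucc = τ := rfl
  have e1 := hC₁ n τ (by omega) (by rw [Fin.succ_castSucc]; exact le_rfl)
  have e2 := hC₁ n (τ - h) (by omega)
    (by rw [Fin.succ_castSucc, hbase]; exact Nat.sub_le _ _)
  have e3 := hC₂ n (τ + h) (by omega) hnext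
  rw [hbase] at e3
  change |F τ - τ * q₁ - _| ≤ _ at e1
  change |F (τ - h) - ((τ - h : ℕ) : ℝ) * q₁ - _| ≤ _ at e2
  change |F (τ + h) - ((τ + h : ℕ) : ℝ) * q₂ - (F τ - τ * q₂)| ≤ _ at e3
  rw [Nat.cast_sub hhτ] at e2
  rw [Nat.cast_add] at e3
  have hbN : bend (samplePath (p.sample n X)) (p.sampleLength n) (S n) (u + 1) B *
      p.sampleLength n ≤ ε * d / 8 * n :=
    mul_le_mul hb.le (p.sampleLength_le n) (Nat.cast_nonneg _) hη.le
  have hhd : h * d ≤ 4 * (ε * d / 8 * n) + (2 * C₁ + C₂) := by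
    have e0 : h * d = |h * (q₂ - q₁)| := by rw [abs_mul, Nat.abs_cast]
    rw [e0]
    have hm := abs_le.1 (hmain.trans hbN)
    rw [abs_le] at e1 e2 e3 ⊢
    constructor <;> linarith [hm.1, hm.2, e1.1, e1.2, e2.1, e2.2, e3.1, e3.2,
      mul_sub (h : ℝ) q₂ q₁, sub_mul (τ : ℝ) h q₁, add_mul (τ : ℝ) h q₂]
  have := mul_lt_mul_of_pos_right hh2 hd
  linarith

lemma tendsto_bend_minBendSet {lam : ℝ} (hle : lam ≤ p.minSeparation)
    {X : Fin (p.κ + 1) → ℕ → ℝ} (hX : p.HasLinearHits X) (u v : ℕ) (i : Fin (u + 1) → ℤ) :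
    Tendsto (fun n => bend (samplePath (p.sample n X)) (p.sampleLength n)
      (minBendSet (samplePath (p.sample n X)) (p.sampleLength n) lam)
      (u + 1) (dyadicCube (u + 1) (v + 1) i)) atTop (𝓝 0) := by
  refine tendsto_bend_zero (x := fun n => samplePath (p.sample n X)) (N := p.sampleLength) ?_ u v i
  refine squeeze_zero' (Eventually.of_forall fun n => totalBend_nonneg _ _ _) ?_
    (tendsto_totalBend_zero hX.tendsto_bend_changePointSet)
  filter_upwards [p.eventually_changePointSet_mem_separatedSets hle] with n hn
  exact (minBendSet_spec _ hn).2

end PSEProcess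

theorem minBendEstimator_isSeparated : minBendEstimator.IsSeparated := by
  refine (ListEstimator.isSeparated_iff _).2 fun p lam _ hle => Eventually.of_forall fun X => ?_
  filter_upwards [p.eventually_changePointSet_mem_separatedSets hle,
    p.eventually_sampleLength_pos] with n hn hN
  exact isChain_sort_of_mem_separatedSets hN (minBendSet_spec _ hn).1

theorem minBendEstimator_isConsistent : minBendEstimator.IsConsistent := by
  intro p lam _ hle
  filter_upwards [p.ae_hasLinearHits] with X hX
  set S : ℕ → Finset ℕ := fun n =>
    minBendSet (samplePath (p.sample n X)) (p.sampleLength n) lam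
  -- `ψ n k` is an element of `S n` that is nearest to the change point `k`
  have hex : ∀ n k, ∃ t, (S n).Nonempty → t ∈ S n ∧
      ∀ s ∈ S n, |(t : ℝ) - p.changePoint n k| ≤ |(s : ℝ) - p.changePoint n k| := by
    intro n k
    by_cases h : (S n).Nonempty
    · obtain ⟨t, ht⟩ := Finset.exists_min_image (S n)
        (fun s : ℕ => |(s : ℝ) - p.changePoint n k|) h
      exact ⟨t, fun _ => ht⟩
    · exact ⟨0, fun h' => absurd h' h⟩
  choose ψ hψ using hex
  have hnear : ∀ ε : ℝ, 0 < ε → ∀ᶠ n : ℕ in atTop, ∀ k,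
      ψ n k ∈ S n ∧ |(ψ n k : ℝ) - p.changePoint n k| ≤ ε * n := by
    intro ε hε
    refine eventually_all.2 fun k => ?_
    filter_upwards [hX.eventually_exists_near (p.tendsto_bend_minBendSet hle hX) k hε]
      with n ⟨s, hs, h⟩
    obtain ⟨h1, h2⟩ := hψ n k ⟨s, hs⟩
    exact ⟨h1, (h2 s hs).trans h⟩
  have hθ := p.θ_last_pos
  refine ⟨ψ, ?_, fun k => Metric.tendsto_nhds.2 fun ε hε => ?_⟩
  · filter_upwards [hnear (p.minSeparation / 8) (by linarith [p.minSeparation_pos]),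
      (tendsto_natCast_atTop_atTop (R := ℝ)).eventually_ge_atTop (2 / p.minSeparation)]
      with n hn hn1
    rw [div_le_iff₀ p.minSeparation_pos] at hn1
    refine ⟨fun k l hkl => ?_, fun k => (Finset.mem_sort _).2 (hn k).1⟩
    by_contra hne
    wlog hlt : k < l generalizing k l with H
    · exact H l k hkl.symm (Ne.symm hne) (lt_of_le_of_ne (not_lt.1 hlt) (Ne.symm hne))
    have hgap := p.boundary_gap (Fin.castSucc_lt_castSucc_iff.2 (Fin.succ_lt_succ_iff.2 hlt)) n
    change _ < (p.changePoint n l : ℝ) - p.changePoint n k at hgap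
    have h1 := abs_le.1 (hn k).2
    have h2 := abs_le.1 (hn l).2
    rw [hkl] at h1
    linarith [h1.1, h1.2, h2.1, h2.2]
  · filter_upwards [hnear (ε * (p.θ (Fin.last _) / 2) / 2) (by positivity),
      p.eventually_mul_le_sampleLength, p.eventually_sampleLength_pos] with n hn hN hpos
    have hpos : (0 : ℝ) < p.sampleLength n := by exact_mod_cast hpos
    rw [Real.dist_eq, sub_zero, abs_div, abs_abs, Nat.abs_cast, div_lt_iff₀ hpos]
    have h1 := (hn k).2
    have h2 := mul_le_mul_of_nonneg_left hN hε.le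
    have h3 := mul_pos hε hpos
    linarith

theorem mainTheorem2 :
    (∃ L : ListEstimator, L.IsConsistent ∧ L.IsSeparated) ∧
    ∀ (L : ListEstimator), L.IsConsistent → L.IsSeparated →
    ∀ (w : ℕ → ℝ), (∀ j, 0 < w j) → Summable w →
    ∀ (p p' : PSEProcess)
      (P : Measure ((Fin (p.κ + 1) → ℕ → ℝ) × (Fin (p'.κ + 1) → ℕ → ℝ))),
      P.map Prod.fst = p.ρ → P.map Prod.snd = p'.ρ →
    ∀ lam : ℝ, 0 < lam → lam ≤ min p.minSeparation p'.minSeparation →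
      ∀ᵐ Z ∂P, Tendsto
        (fun n => deltaEstimate w L lam (p.sample n Z.1) (p'.sample n Z.2)) atTop
        (𝓝 (classDist w ⟦p⟧ ⟦p'⟧)) :=
  ⟨⟨minBendEstimator, minBendEstimator_isConsistent, minBendEstimator_isSeparated⟩,
    ae_tendsto_deltaEstimate⟩
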